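/- Let $H$ be a real separable Hilbert space, $B$ a Banach space and $i:H\to B$ a continuous linear injection with dense range such that $(i,H,B)$ is an abstract Wiener space in the sense of Gross: for all $\varepsilon,h>0$ there is a finite-dimensional subspace $F\subset H$ such that $\mu_{E,h}(\{y\in E:\ \|i(y)\|_B>\varepsilon\})<\varepsilon$ for every finite-dimensional subspace $E\subset H$ orthogonal to $F$, where $d\mu_{E,h}(y)=(2\pi h)^{-\dim(E)/2}e^{-|y|^2/(2h)}\,d\lambda(y)$. Identify $B'\subset H'=H\subset B$. Then $(i\times i,H^2,B^2)$ is an abstract Wiener space as well. For $h>0$ let $\mu_{B^2,h}$ be the Borel probability measure on $B^2$ under which every finite system in $(B^2)'$ that is orthonormal in $H^2$ is a system of independent centred Gaussian variables of variance $h$. Let $a\mapsto\ell_a$ be the continuous extension to $H^2$ of the map $(B^2)'\to L^2(B^2,\mu_{B^2,h})$ that sends a functional to its class. For a finite-dimensional subspace $E\subset H^2$ with orthonormal basis $(u_j)$ put $\widetilde\pi_E(x)=\sum_j\ell_{u_j}(x)\,u_j$ (for almost every $x\in B^2$). A Borel function $f$ on $H^2$ is said to admit the Borel function $\widetilde f$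 on $B^2$ as a stochastic extension with respect to $\mu_{B^2,h}$ if, for every increasing sequence $(E_n)$ of finite-dimensional subspaces of $H^2$ with dense union, $f\circ\widetilde\pi_{E_n}\to\widetilde f$ in $\mu_{B^2,h}$-probability. It is said to admit $\widetilde f\in L^p(B^2,\mu_{B^2,h})$ as a stochastic extension in the sense of $L^p(B^2,\mu_{B^2,h})$ if, for every such sequence, the functions $f\circ\widetilde\pi_{E_n}$ are in $L^p(B^2,\mu_{B^2,h})$ and converge to $\widetilde f$ in $L^p(B^2,\mu_{B^2,h})$. **Proposition 8.10.** Let $h>0$ and let $T$ be a positive, self-adjoint, trace-class operator on $H^2$. For $X\in H^2$ and $t>0$ set $$\varphi(X)=\langle TX,X\rangle,\qquad F_t(X)=e^{-t\varphi(X)}.$$ Then: 1. $\varphi$ has a stochastic extension $\widetilde\varphi$ in the sense of $L^2(B^2,\mu_{B^2,h/2})$; 2. the norm $$N_2(\widetilde\varphi)=\sup_{Y\in H^2}\frac{\|\widetilde\varphi(\cdot+Y)\|_{L^1(B^2,\mu_{B^2,h/2})}}{(1+|Y|)^2}$$ is finite; 3. for every $t>0$, $F_t$ admits a stochastic extension with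 respect to $\mu_{B^2,h/2}$; 4. for every bounded continuous function $G:\mathbb R\to\mathbb C$, the function $X\mapsto G(\varphi(X))$ admits a stochastic extension with respect to $\mu_{B^2,h/2}$. -/

import Mathlib

open MeasureTheory ProbabilityTheory Filter
open scoped ENNReal Topology BoundedContinuousFunction

noncomputable section

namespace WienerSpace

universe u v

/-- The centred Gaussian measure with variance parameter `h` on a finite-dimensional Euclidean
space `V`, given by the density `(2πh)^(-dim V / 2) exp(-|y|² / (2h))` with respect to the
Lebesgue measure normalized by the norm of `V`. -/
def finGaussian (V : Type u) [NormedAddCommGroup V] [InnerProductSpace ℝ V]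
    [FiniteDimensional ℝ V] [MeasurableSpace V] [BorelSpace V] (h : ℝ) : Measure V :=
  (volume : Measure V).withDensity fun y =>
    ENNReal.ofReal
      ((2 * Real.pi * h) ^ (-(Module.finrank ℝ V : ℝ) / 2) * Real.exp (-‖y‖ ^ 2 / (2 * h)))

/-- `(i, H, B)` is an abstract Wiener space in the sense of Gross: `i : H → B` is a continuous
linear injection with dense range and the norm of `B` is measurable, i.e. for all `ε, h > 0` there
is a finite-dimensional `F ⊆ H` such that for every finite-dimensional `E` orthogonal to `F`,
`μ_{H,h} {x | ‖i (π_E x)‖ > ε} = μ_{E,h} {y ∈ E | ‖i y‖ > ε} < ε`. -/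
structure IsAbstractWienerSpace {H : Type u} {B : Type v}
    [NormedAddCommGroup H] [InnerProductSpace ℝ H] [MeasurableSpace H] [BorelSpace H]
    [NormedAddCommGroup B] [NormedSpace ℝ B] (i : H →L[ℝ] B) : Prop where
  injective : Function.Injective i
  denseRange : DenseRange i
  measurable_norm : ∀ ε : ℝ, 0 < ε → ∀ h : ℝ, 0 < h →
    ∃ F : Submodule ℝ H, FiniteDimensional ℝ F ∧
      ∀ (E : Submodule ℝ H) [FiniteDimensional ℝ E], E ≤ Fᗮ →
        finGaussian E h {y : E | ε < ‖i (y : H)‖} < ENNReal.ofReal ε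

section General

variable {H : Type u} {B : Type v}
  [NormedAddCommGroup H] [InnerProductSpace ℝ H] [CompleteSpace H]
  [NormedAddCommGroup B] [NormedSpace ℝ B]

/-- The inclusion `B' ⊆ H' = H`: the functional `u` on `B` is sent to the vector `a` of `H` with
`u (i x) = ⟪a, x⟫` for all `x` in `H`. -/
def dualIncl (i : H →L[ℝ] B) : StrongDual ℝ B →ₗ[ℝ] H where
  toFun u := (InnerProductSpace.toDual ℝ H).symm (u.comp i)
  map_add' u w := by simp [ContinuousLinearMap.add_comp]
  map_smul' c u := by simp [ContinuousLinearMap.smul_comp]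

/-- The characteristic property of the Gaussian measure `μ_{B,h}`: it is a probability measure on
the Borel sets of `B` and, under it, every finite system of functionals in `B'` which is
orthonormal for the scalar product of `H` is a system of independent centred Gaussian variables of
variance `h`. -/
structure IsWienerMeasure [MeasurableSpace B] (i : H →L[ℝ] B) (h : ℝ) (μ : Measure B) :
    Prop where
  isProbabilityMeasure : IsProbabilityMeasure μ
  map_eq : ∀ (n : ℕ) (w : Fin n → StrongDual ℝ B), Orthonormal ℝ (fun j => dualIncl i (w j)) →
    μ.map (fun (x : B) (j : Fin n) => w j x) =
      Measure.pi fun _ : Fin n => gaussianReal 0 h.toNNReal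

open Classical in
/-- The Gaussian measure `μ_{B,h}` of an abstract Wiener space `(i, H, B)`, `h > 0`: the unique
measure satisfying `IsWienerMeasure i h`. (By the theorem of Gross it exists for every abstract
Wiener space; the value `0` is taken only when there is no such measure.) -/
def wienerMeasure [MeasurableSpace B] (i : H →L[ℝ] B) (h : ℝ) : Measure B :=
  if hμ : ∃ μ : Measure B, IsWienerMeasure i h μ then hμ.choose else 0

variable [MeasurableSpace B] [OpensMeasurableSpace B]

/-- The map `a ↦ ℓ_a` from `H` to `L²(B, μ_{B,h})`: the continuous extension to `H` (along
`B' ⊆ H`) of the map which sends a functional in `B'` to its class in `L²(B, μ_{B,h})`. -/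
def ell (i : H →L[ℝ] B) (h : ℝ) : H →L[ℝ] Lp ℝ 2 (wienerMeasure i h) :=
  (StrongDual.toLp (wienerMeasure i h) 2).toLinearMap.extendOfNorm (dualIncl i)

/-- The extended projection `x ↦ ∑ j, ℓ_{u_j}(x) u_j` from `B` to a finite-dimensional subspace `E`
of `H`, where `(u_j)` is an orthonormal basis of `E` (almost everywhere, it does not depend on the
basis). -/
def projTilde (i : H →L[ℝ] B) (h : ℝ) (E : Submodule ℝ H) [FiniteDimensional ℝ E] (x : B) : H :=
  ∑ j, (ell i h (stdOrthonormalBasis ℝ E j : H) : B → ℝ) x • (stdOrthonormalBasis ℝ E j : H)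

/-- The Borel function `f` on `H` admits the Borel function `g` on `B` as stochastic extension with
respect to `μ_{B,h}`: for every increasing sequence `(E n)` of finite-dimensional subspaces of `H`
with dense union, `f ∘ π̃_{E n}` converges to `g` in probability. -/
def IsStochasticExtension [MeasurableSpace H] {F : Type*} [NormedAddCommGroup F]
    [MeasurableSpace F] (i : H →L[ℝ] B) (h : ℝ) (f : H → F) (g : B → F) : Prop :=
  Measurable f ∧ Measurable g ∧
    ∀ (E : ℕ → Submodule ℝ H) [∀ n, FiniteDimensional ℝ (E n)], Monotone E →
      Dense (⋃ n, (E n : Set H)) →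
        TendstoInMeasure (wienerMeasure i h) (fun n x => f (projTilde i h (E n) x)) atTop g

/-- The function `f` on `H` admits `g ∈ L^p(B, μ_{B,h})` as stochastic extension in the sense of
`L^p(B, μ_{B,h})`: for every increasing sequence `(E n)` of finite-dimensional subspaces of `H`
with dense union, the functions `f ∘ π̃_{E n}` are in `L^p` and converge to `g` in `L^p`. -/
def IsLpStochasticExtension {F : Type*} [NormedAddCommGroup F]
    (i : H →L[ℝ] B) (h : ℝ) (p : ℝ≥0∞) (f : H → F) (g : B → F) : Prop :=
  MemLp g p (wienerMeasure i h) ∧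
    ∀ (E : ℕ → Submodule ℝ H) [∀ n, FiniteDimensional ℝ (E n)], Monotone E →
      Dense (⋃ n, (E n : Set H)) →
        (∀ n, MemLp (fun x => f (projTilde i h (E n) x)) p (wienerMeasure i h)) ∧
        Tendsto (fun n => eLpNorm (fun x => f (projTilde i h (E n) x) - g x) p
          (wienerMeasure i h)) atTop (𝓝 0)

/-- The norm `sup_{Y ∈ H} ‖g(· + Y)‖_{L¹(B, μ_{B,s})} / (1 + |Y|)^m`, as an element of `[0, ∞]`.
(On the phase space `B²` it is taken with `s = h / 2`.) -/
def growthNorm {F : Type*} [NormedAddCommGroup F]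
    (i : H →L[ℝ] B) (s : ℝ) (m : ℕ) (g : B → F) : ℝ≥0∞ :=
  ⨆ Y : H, eLpNorm (fun x => g (x + i Y)) 1 (wienerMeasure i s) /
    ENNReal.ofReal ((1 + ‖Y‖) ^ m)

end General

/-- The Hilbert space `H²`, with the norm `|(x, ξ)|² = |x|² + |ξ|²`. -/
abbrev Phase (H : Type u) : Type u := WithLp 2 (H × H)

/-- The injection `(x, ξ) ↦ (i x, i ξ)` of `H²` into `B²`. -/
def phaseIncl {H : Type u} {B : Type v} [NormedAddCommGroup H] [InnerProductSpace ℝ H]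
    [NormedAddCommGroup B] [NormedSpace ℝ B] (i : H →L[ℝ] B) : Phase H →L[ℝ] B × B :=
  (i.prodMap i).comp (WithLp.prodContinuousLinearEquiv 2 ℝ H H).toContinuousLinearMap

/-- `T` is a positive, self-adjoint, trace-class operator on the real Hilbert space `K`. As `T` is
positive, `|T| = T`, so being trace-class means that the trace `∑ j, ⟪T e_j, e_j⟫` is finite for
one (equivalently, every) Hilbert basis `(e_j)`. -/
def IsPositiveTraceClass {K : Type u} [NormedAddCommGroup K] [InnerProductSpace ℝ K]
    (T : K →L[ℝ] K) : Prop :=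
  T.IsPositive ∧
    ∃ (ι : Type u) (e : HilbertBasis ι ℝ K), Summable fun j => inner ℝ (T (e j)) (e j)

end WienerSpace

end

namespace WienerSpace

/-! Put `s = h / 2`. Under `μ_{B²,s}` the map `a ↦ ℓ_a` is an isonormal process: `ℓ_a` is centred
Gaussian of variance `s |a|²`. A positive trace-class `T` can be written `T = ∑ a_k ⊗ a_k` with `∑
|a_k|² < ∞` (`exists_hasSum_inner_mul_inner`), so `φ ∘ π̃_E = ∑ (ℓ_{π_E a_k})²`. Since fourth
moments of Gaussians are finite, `(a, b) ↦ ℓ_a ℓ_b` is a bounded bilinear map into `L²`. As `π_{E_n}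
a_k → a_k` and the terms are dominated by a multiple of `|a_k|²`, the series converge in `L²` to `φ̃
= ∑ ℓ_{a_k}²`; this is the first claim.

For the growth norm, the Cameron–Martin formula makes translations by `i Y` preserve null sets, so
almost sure convergence along a subsequence holds at `x` and at `x + i Y` together. With `π̃_E (x +
i Y) = π̃_E x + π_E Y` and `φ(X + Y) ≤ 2 φ(X) + 2 φ(Y)`, this gives `0 ≤ φ̃(x + i Y) ≤ 2 φ̃(x) + 2
‖T‖ |Y|²` almost everywhere. The last two claims follow because continuous functions preserve
convergence in probability.

All this needs the measure to exist. Gross's theorem is proved on `B`, by Borel–Cantelli applied to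
the increments of finite-dimensional Gaussian vectors, and the product measure then serves on `B²`.
-/

theorem norm_cexp_mul_I_sub_le (x y : ℝ) :
    ‖Complex.exp (x * Complex.I) - Complex.exp (y * Complex.I)‖ ≤ |x - y| := by
  have h : Complex.exp (x * Complex.I) - Complex.exp (y * Complex.I)
      = Complex.exp (y * Complex.I) * (Complex.exp (Complex.I * ((x - y : ℝ) : ℂ)) - 1) := by
    rw [mul_sub, ← Complex.exp_add]
    push_cast
    ring_nf
  rw [h, norm_mul, Complex.norm_exp_ofReal_mul_I, one_mul]
  exact Real.norm_exp_I_mul_ofReal_sub_one_le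

/-! ### Isonormal processes: laws, moments and products -/

section Isonormal

variable {Ω : Type*} {mΩ : MeasurableSpace Ω} {P : Measure Ω}

theorem integrable_cexp_mul_I [IsFiniteMeasure P] {f : Ω → ℝ} (hf : AEStronglyMeasurable f P) :
    Integrable (fun ω => Complex.exp (f ω * Complex.I)) P := by
  refine Integrable.of_bound (C := 1) ?_ (ae_of_all _ fun ω => ?_)
  · exact (by fun_prop : Continuous fun x : ℝ => Complex.exp (x * Complex.I)).comp_aestronglyMeasurable
      hf
  · rw [Complex.norm_exp_ofReal_mul_I]

/-- `x ↦ exp (i x)` is 1-Lipschitz and the `L¹` norm is at most the `L²` norm. This continuity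
carries characteristic function identities from a dense set of indices to all of them. -/
theorem lipschitzWith_integral_cexp [IsProbabilityMeasure P] :
    LipschitzWith 1 fun f : Lp ℝ 2 P => ∫ ω, Complex.exp (f ω * Complex.I) ∂P := by
  refine LipschitzWith.of_dist_le_mul fun f g => ?_
  rw [dist_eq_norm, ← integral_sub (integrable_cexp_mul_I (Lp.aestronglyMeasurable f))
    (integrable_cexp_mul_I (Lp.aestronglyMeasurable g)), dist_eq_norm, NNReal.coe_one, one_mul]
  have hfg : MemLp (f - g : Lp ℝ 2 P) 1 P := (Lp.memLp (f - g)).mono_exponent (by norm_num)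
  calc ‖∫ ω, Complex.exp (f ω * Complex.I) - Complex.exp (g ω * Complex.I) ∂P‖
      ≤ ∫ ω, ‖(f - g : Lp ℝ 2 P) ω‖ ∂P := by
        refine norm_integral_le_of_norm_le (hfg.integrable le_rfl).norm ?_
        filter_upwards [Lp.coeFn_sub f g] with ω hω
        rw [hω]
        exact norm_cexp_mul_I_sub_le _ _
    _ = (eLpNorm (f - g : Lp ℝ 2 P) 1 P).toReal := by
        rw [eLpNorm_one_eq_lintegral_enorm, integral_norm_eq_lintegral_enorm hfg.1]
    _ ≤ ‖f - g‖ := by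
        rw [Lp.norm_def]
        refine ENNReal.toReal_mono (Lp.memLp _).eLpNorm_ne_top ?_
        exact eLpNorm_le_eLpNorm_of_exponent_le (by norm_num) hfg.1

variable {K : Type*} [NormedAddCommGroup K] [InnerProductSpace ℝ K]

/-- `W` is an isonormal Gaussian process of variance `s` indexed by the Hilbert space `K`: the
variable `W a` is centred Gaussian of variance `s ‖a‖²`, as expressed by its characteristic
function. -/
def IsIsonormal (P : Measure Ω) (s : ℝ) (W : K →L[ℝ] Lp ℝ 2 P) : Prop :=
  ∀ a, ∫ ω, Complex.exp (W a ω * Complex.I) ∂P = Complex.exp (-(s * ‖a‖ ^ 2 / 2 : ℝ))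

theorem IsIsonormal.of_denseRange [IsProbabilityMeasure P] {s : ℝ} {W : K →L[ℝ] Lp ℝ 2 P}
    {ι : Type*} {e : ι → K} (he : DenseRange e)
    (h : ∀ j, ∫ ω, Complex.exp (W (e j) ω * Complex.I) ∂P
      = Complex.exp (-(s * ‖e j‖ ^ 2 / 2 : ℝ))) : IsIsonormal P s W := by
  have h1 : Continuous fun a => ∫ ω, Complex.exp (W a ω * Complex.I) ∂P :=
    (lipschitzWith_integral_cexp (P := P)).continuous.comp W.continuous
  have h2 : Continuous fun a : K => Complex.exp (-(s * ‖a‖ ^ 2 / 2 : ℝ)) := by fun_prop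
  exact congrFun (he.equalizer h1 h2 (funext h))

/-- A real variable whose characteristic function is `exp (-v t² / 2)` is centred Gaussian of
variance `v`. -/
theorem map_eq_gaussianReal_of_charFun [IsProbabilityMeasure P] {X : Ω → ℝ}
    (hX : AEMeasurable X P) {v : ℝ} (hv : 0 ≤ v)
    (h : ∀ t : ℝ, ∫ ω, Complex.exp ((t * X ω : ℝ) * Complex.I) ∂P
      = Complex.exp (-(v * t ^ 2 / 2 : ℝ))) :
    P.map X = gaussianReal 0 v.toNNReal := by
  have := Measure.isProbabilityMeasure_map hX
  refine Measure.ext_of_charFun (funext fun t => ?_)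
  rw [charFun_apply_real, charFun_gaussianReal, integral_map hX (by fun_prop)]
  have := h t
  push_cast at this
  rw [this]
  congr 1
  rw [Real.coe_toNNReal _ hv]
  simp

theorem IsIsonormal.map_eq [IsProbabilityMeasure P] {s : ℝ} (hs : 0 ≤ s) {W : K →L[ℝ] Lp ℝ 2 P}
    (hW : IsIsonormal P s W) (a : K) :
    P.map (W a) = gaussianReal 0 (s * ‖a‖ ^ 2).toNNReal := by
  refine map_eq_gaussianReal_of_charFun (Lp.aestronglyMeasurable _).aemeasurable (by positivity)
    fun t => ?_
  have h := hW (t • a)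
  rw [norm_smul, mul_pow, Real.norm_eq_abs, sq_abs, map_smul] at h
  rw [show s * ‖a‖ ^ 2 * t ^ 2 / 2 = s * (t ^ 2 * ‖a‖ ^ 2) / 2 by ring, ← h]
  refine integral_congr_ae ?_
  filter_upwards [Lp.coeFn_smul t (W a)] with ω hω
  rw [hω]
  simp

theorem eLpNorm_of_map_eq_gaussianReal {X : Ω → ℝ} (hX : AEMeasurable X P) {v : ℝ} (hv : 0 ≤ v)
    (h : P.map X = gaussianReal 0 v.toNNReal) (p : ℝ≥0∞) :
    eLpNorm X p P = ENNReal.ofReal (√v) * eLpNorm id p (gaussianReal 0 1) := by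
  have h1 : P.map X = (gaussianReal 0 1).map (fun x => √v * x) := by
    rw [h, gaussianReal_map_const_mul]
    congr 1
    · simp
    · ext
      simp [Real.sq_sqrt hv, Real.coe_toNNReal _ hv]
  have h2 : eLpNorm X p P = eLpNorm id p (P.map X) := by
    rw [eLpNorm_map_measure (by fun_prop) hX]; rfl
  rw [h2, h1, eLpNorm_map_measure (by fun_prop) (by fun_prop)]
  have : (id ∘ fun x : ℝ => √v * x) = √v • (id : ℝ → ℝ) := rfl
  rw [this, eLpNorm_const_smul, Real.enorm_of_nonneg (Real.sqrt_nonneg _)]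

theorem eLpNorm_id_gaussianReal_ne_top (p : NNReal) :
    eLpNorm id p (gaussianReal 0 1) ≠ ∞ :=
  (memLp_id_gaussianReal p).eLpNorm_ne_top

theorem IsIsonormal.eLpNorm_eq [IsProbabilityMeasure P] {s : ℝ} (hs : 0 ≤ s)
    {W : K →L[ℝ] Lp ℝ 2 P} (hW : IsIsonormal P s W) (a : K) (p : ℝ≥0∞) :
    eLpNorm (W a) p P = ENNReal.ofReal (√s * ‖a‖) * eLpNorm id p (gaussianReal 0 1) := by
  rw [eLpNorm_of_map_eq_gaussianReal (Lp.aestronglyMeasurable _).aemeasurable (by positivity)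
    (hW.map_eq hs a), Real.sqrt_mul hs, Real.sqrt_sq (norm_nonneg _)]

theorem IsIsonormal.memLp [IsProbabilityMeasure P] {s : ℝ} (hs : 0 ≤ s)
    {W : K →L[ℝ] Lp ℝ 2 P} (hW : IsIsonormal P s W) (a : K) (p : NNReal) :
    MemLp (W a) p P := by
  refine ⟨Lp.aestronglyMeasurable _, ?_⟩
  rw [hW.eLpNorm_eq hs]
  exact ENNReal.mul_lt_top ENNReal.ofReal_lt_top (eLpNorm_id_gaussianReal_ne_top p).lt_top

instance : ENNReal.HolderTriple 4 4 2 where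
  inv_add_inv_eq_inv := by
    rw [← two_mul, show (4 : ℝ≥0∞) = 2 * 2 by norm_num, ENNReal.mul_inv (by simp) (by simp),
      ← mul_assoc, ENNReal.mul_inv_cancel (by simp) (by simp), one_mul]

theorem IsIsonormal.memLp_mul [IsProbabilityMeasure P] {s : ℝ} (hs : 0 ≤ s)
    {W : K →L[ℝ] Lp ℝ 2 P} (hW : IsIsonormal P s W) (a b : K) :
    MemLp (fun ω => W a ω * W b ω) 2 P :=
  MemLp.mul (p := 4) (q := 4) (hW.memLp hs b 4) (hW.memLp hs a 4)

/-- Hölder with `1/4 + 1/4 = 1/2`; the `L⁴` norm of `W a` is `√s ‖a‖` times that of a standard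
Gaussian. -/
theorem IsIsonormal.norm_toLp_mul_le [IsProbabilityMeasure P] {s : ℝ} (hs : 0 ≤ s)
    {W : K →L[ℝ] Lp ℝ 2 P} (hW : IsIsonormal P s W) (a b : K) :
    ‖(hW.memLp_mul hs a b).toLp‖
      ≤ (s * (eLpNorm id 4 (gaussianReal 0 1)).toReal ^ 2) * ‖a‖ * ‖b‖ := by
  rw [Lp.norm_toLp]
  have h := eLpNorm_smul_le_mul_eLpNorm (p := 4) (q := 4) (r := 2)
    (hW.memLp hs b 4).1 (hW.memLp hs a 4).1
  refine (ENNReal.toReal_mono (ENNReal.mul_ne_top (hW.memLp hs a 4).eLpNorm_ne_top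
    (hW.memLp hs b 4).eLpNorm_ne_top) h).trans_eq ?_
  simp only [hW.eLpNorm_eq hs, ENNReal.toReal_mul, show ((4 : NNReal) : ℝ≥0∞) = 4 from rfl]
  rw [ENNReal.toReal_ofReal (by positivity), ENNReal.toReal_ofReal (by positivity)]
  nth_rewrite 3 [← Real.mul_self_sqrt hs]
  ring

/-- The continuous bilinear map `(a, b) ↦ W a * W b` with values in `L²`. -/
noncomputable def IsIsonormal.mulBilin [IsProbabilityMeasure P] {s : ℝ} (hs : 0 ≤ s)
    {W : K →L[ℝ] Lp ℝ 2 P} (hW : IsIsonormal P s W) : K →L[ℝ] K →L[ℝ] Lp ℝ 2 P :=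
  LinearMap.mkContinuous₂
    (LinearMap.mk₂ ℝ (fun a b => (hW.memLp_mul hs a b).toLp)
      (fun a a' b => by
        rw [← MemLp.toLp_add, MemLp.toLp_eq_toLp_iff, map_add]
        filter_upwards [Lp.coeFn_add (W a) (W a')] with ω hω
        change (W a + W a' : Lp ℝ 2 P) ω * W b ω = W a ω * W b ω + W a' ω * W b ω
        rw [hω, Pi.add_apply, add_mul])
      (fun c a b => by
        rw [← MemLp.toLp_const_smul, MemLp.toLp_eq_toLp_iff, map_smul]
        filter_upwards [Lp.coeFn_smul c (W a)] with ω hω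
        simp [hω, mul_assoc])
      (fun a b b' => by
        rw [← MemLp.toLp_add, MemLp.toLp_eq_toLp_iff, map_add]
        filter_upwards [Lp.coeFn_add (W b) (W b')] with ω hω
        change W a ω * (W b + W b' : Lp ℝ 2 P) ω = W a ω * W b ω + W a ω * W b' ω
        rw [hω, Pi.add_apply, mul_add])
      (fun c a b => by
        rw [← MemLp.toLp_const_smul, MemLp.toLp_eq_toLp_iff, map_smul]
        filter_upwards [Lp.coeFn_smul c (W b)] with ω hω
        simp [hω, mul_left_comm]))
    (s * (eLpNorm id 4 (gaussianReal 0 1)).toReal ^ 2) (hW.norm_toLp_mul_le hs)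

theorem IsIsonormal.coeFn_mulBilin [IsProbabilityMeasure P] {s : ℝ} (hs : 0 ≤ s)
    {W : K →L[ℝ] Lp ℝ 2 P} (hW : IsIsonormal P s W) (a b : K) :
    hW.mulBilin hs a b =ᵐ[P] fun ω => W a ω * W b ω :=
  MemLp.coeFn_toLp (hW.memLp_mul hs a b)

end Isonormal

end WienerSpace

namespace WienerSpace

/-! ### The Wiener measure through its characteristic function -/

section WienerMeasure

variable {H : Type*} {B : Type*}
  [NormedAddCommGroup H] [InnerProductSpace ℝ H] [CompleteSpace H]
  [NormedAddCommGroup B] [NormedSpace ℝ B]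

theorem inner_dualIncl (i : H →L[ℝ] B) (u : StrongDual ℝ B) (x : H) :
    inner ℝ (dualIncl i u) x = u (i x) := by
  simp [dualIncl]

theorem dualIncl_injective {i : H →L[ℝ] B} (hi : DenseRange i) :
    Function.Injective (dualIncl i) := by
  rw [injective_iff_map_eq_zero]
  intro u hu
  have h : (u : B → ℝ) ∘ i = (0 : StrongDual ℝ B) ∘ i := by
    funext x
    simp [← inner_dualIncl, hu]
  exact DFunLike.coe_injective (hi.equalizer u.continuous (ContinuousLinearMap.continuous 0) h)

/-- If `x` is orthogonal to the range, every functional on `B` vanishes at `i x`, so `i x = 0` by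
Hahn–Banach. -/
theorem denseRange_dualIncl {i : H →L[ℝ] B} (hi : Function.Injective i) :
    DenseRange (dualIncl i) := by
  have h : (LinearMap.range (dualIncl i))ᗮ = ⊥ := by
    rw [Submodule.eq_bot_iff]
    intro x hx
    rw [Submodule.mem_orthogonal] at hx
    refine hi ?_
    rw [map_zero]
    refine SeparatingDual.eq_zero_of_forall_dual_eq_zero (R := ℝ) fun u => ?_
    rw [← inner_dualIncl]
    exact hx _ ⟨u, rfl⟩
  have h' := Submodule.topologicalClosure_eq_top_iff.2 h
  rw [DenseRange, ← LinearMap.coe_range, ← Submodule.dense_iff_topologicalClosure_eq_top] at *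
  exact h'

variable [MeasurableSpace B]

theorem isWienerMeasure_wienerMeasure {i : H →L[ℝ] B} {s : ℝ}
    (h : ∃ μ : Measure B, IsWienerMeasure i s μ) : IsWienerMeasure i s (wienerMeasure i s) := by
  rw [wienerMeasure, dif_pos h]
  exact h.choose_spec

variable [BorelSpace B]

/-- Only one-element orthonormal systems are needed: `u` is rescaled to a unit vector of `H`. -/
theorem IsWienerMeasure.charFunDual_eq {i : H →L[ℝ] B} (hi : DenseRange i) {s : ℝ} (hs : 0 ≤ s)
    {μ : Measure B} (hμ : IsWienerMeasure i s μ) (u : StrongDual ℝ B) :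
    charFunDual μ u = Complex.exp (-(s * ‖dualIncl i u‖ ^ 2 / 2 : ℝ)) := by
  have := hμ.isProbabilityMeasure
  by_cases h0 : dualIncl i u = 0
  · have : u = 0 := dualIncl_injective hi (by simpa using h0)
    simp [this, charFunDual_apply]
  have hn : ‖dualIncl i u‖ ≠ 0 := by simpa using h0
  set w : StrongDual ℝ B := ‖dualIncl i u‖⁻¹ • u with hw
  have hon : Orthonormal ℝ fun _ : Fin 1 => dualIncl i w := by
    refine ⟨fun _ => ?_, fun j k hjk => absurd (Subsingleton.elim j k) hjk⟩
    rw [hw, map_smul, norm_smul, norm_inv, norm_norm, inv_mul_cancel₀ hn]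
  have h1 := congrArg (Measure.map (Function.eval 0)) (hμ.map_eq 1 (fun _ => w) hon)
  rw [(measurePreserving_eval (fun _ : Fin 1 => gaussianReal 0 s.toNNReal) 0).map_eq,
    Measure.map_map (by fun_prop) (by fun_prop)] at h1
  have h2 : μ.map w = gaussianReal 0 s.toNNReal := h1
  have hu : u = ‖dualIncl i u‖ • w := by rw [hw, smul_smul, mul_inv_cancel₀ hn, one_smul]
  rw [hu, ← charFun_map_eq_charFunDual_smul, h2, charFun_gaussianReal, ← hu]
  congr 1
  rw [Real.coe_toNNReal _ hs]
  push_cast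
  ring

/-- The characteristic function of `(w_j)` at `t` is that of `μ` at `∑ t_j w_j`, and it factors by
Pythagoras. -/
theorem isWienerMeasure_of_charFunDual {i : H →L[ℝ] B} {s : ℝ} (hs : 0 ≤ s)
    {μ : Measure B} [IsProbabilityMeasure μ]
    (hμ : ∀ u : StrongDual ℝ B,
      charFunDual μ u = Complex.exp (-(s * ‖dualIncl i u‖ ^ 2 / 2 : ℝ))) :
    IsWienerMeasure i s μ := by
  refine ⟨inferInstance, fun n w hw => ?_⟩
  have hmeas : Measurable fun (x : B) (j : Fin n) => w j x := by fun_prop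
  have := Measure.isProbabilityMeasure_map (μ := μ) hmeas.aemeasurable
  rw [← charFun_eq_pi_iff]
  intro t
  have h1 : charFun (Measure.map (WithLp.toLp 2) (μ.map fun (x : B) (j : Fin n) => w j x)) t
      = charFunDual μ (∑ j, t j • w j) := by
    rw [charFun_apply, Measure.map_map (by fun_prop) hmeas,
      integral_map (by fun_prop) (by fun_prop), charFunDual_apply]
    refine integral_congr_ae (ae_of_all _ fun x => ?_)
    simp only [Function.comp, PiLp.inner_apply]
    simp [mul_comm]
  rw [h1, hμ, ← real_inner_self_eq_norm_sq]
  simp only [map_sum, map_smul, charFun_gaussianReal]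
  rw [hw.inner_sum, ← Complex.exp_sum]
  congr 1
  rw [Real.coe_toNNReal _ hs]
  push_cast
  simp [Finset.mul_sum, Finset.sum_div, pow_two]

theorem IsWienerMeasure.map_eq_gaussianReal {i : H →L[ℝ] B} (hi : DenseRange i) {s : ℝ}
    (hs : 0 ≤ s) {μ : Measure B} (hμ : IsWienerMeasure i s μ) (u : StrongDual ℝ B) :
    μ.map u = gaussianReal 0 (s * ‖dualIncl i u‖ ^ 2).toNNReal := by
  have := hμ.isProbabilityMeasure
  refine map_eq_gaussianReal_of_charFun (by fun_prop) (by positivity) fun t => ?_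
  have h := hμ.charFunDual_eq hi hs (t • u)
  rw [map_smul, norm_smul, mul_pow, Real.norm_eq_abs, sq_abs, charFunDual_apply] at h
  rw [show s * ‖dualIncl i u‖ ^ 2 * t ^ 2 / 2 = s * (t ^ 2 * ‖dualIncl i u‖ ^ 2) / 2 by ring, ← h]
  rfl

/-- Gaussian measures have second moments. `StrongDual.toLp` sends a functional to its class only
under this integrability. -/
theorem IsWienerMeasure.memLp_id_two [CompleteSpace B] [SecondCountableTopology B]
    {i : H →L[ℝ] B} (hi : DenseRange i) {s : ℝ}
    (hs : 0 ≤ s) {μ : Measure B} (hμ : IsWienerMeasure i s μ) : MemLp id 2 μ := by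
  have : IsGaussian μ := isGaussian_of_map_eq_gaussianReal fun L =>
    ⟨_, _, hμ.map_eq_gaussianReal hi hs L⟩
  exact IsGaussian.memLp_two_id

variable [CompleteSpace B] [SecondCountableTopology B]

/-- The bound that `extendOfNorm` requires in order to be a genuine extension. -/
theorem exists_norm_toLp_le {i : H →L[ℝ] B} (hi : DenseRange i) {s : ℝ}
    (hs : 0 ≤ s) {μ : Measure B} (hμ : IsWienerMeasure i s μ) :
    ∃ C, ∀ u : StrongDual ℝ B,
      ‖(StrongDual.toLp (𝕜 := ℝ) μ 2).toLinearMap u‖ ≤ C * ‖dualIncl i u‖ := by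
  refine ⟨√s * (eLpNorm id 2 (gaussianReal 0 1)).toReal, fun u => le_of_eq ?_⟩
  rw [ContinuousLinearMap.coe_coe, StrongDual.toLp_apply (hμ.memLp_id_two hi hs), Lp.norm_toLp,
    eLpNorm_of_map_eq_gaussianReal (by fun_prop) (by positivity) (hμ.map_eq_gaussianReal hi hs u),
    ENNReal.toReal_mul, Real.sqrt_mul hs, Real.sqrt_sq (norm_nonneg _),
    ENNReal.toReal_ofReal (by positivity)]
  ring

theorem ell_dualIncl {i : H →L[ℝ] B} (hinj : Function.Injective i)
    (hi : DenseRange i) {s : ℝ} (hs : 0 ≤ s) (hμ : IsWienerMeasure i s (wienerMeasure i s))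
    (u : StrongDual ℝ B) :
    ell i s (dualIncl i u) =ᵐ[wienerMeasure i s] u := by
  rw [ell, LinearMap.extendOfNorm_eq (denseRange_dualIncl hinj) (exists_norm_toLp_le hi hs hμ),
    ContinuousLinearMap.coe_coe, StrongDual.toLp_apply (hμ.memLp_id_two hi hs)]
  exact MemLp.coeFn_toLp _

theorem isIsonormal_ell {i : H →L[ℝ] B} (hinj : Function.Injective i)
    (hi : DenseRange i) {s : ℝ} (hs : 0 ≤ s) (hμ : IsWienerMeasure i s (wienerMeasure i s)) :
    IsIsonormal (wienerMeasure i s) s (ell i s) := by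
  have := hμ.isProbabilityMeasure
  refine IsIsonormal.of_denseRange (denseRange_dualIncl hinj) fun u => ?_
  rw [← hμ.charFunDual_eq hi hs, charFunDual_apply]
  refine integral_congr_ae ?_
  filter_upwards [ell_dualIncl hinj hi hs hμ u] with x hx
  rw [hx]

end WienerMeasure

end WienerSpace

namespace WienerSpace

/-! ### Independence and joint transforms of an isonormal process -/

section Isonormal

variable {Ω : Type*} {mΩ : MeasurableSpace Ω} {P : Measure Ω} [IsProbabilityMeasure P]
  {K : Type*} [NormedAddCommGroup K] [InnerProductSpace ℝ K]

/-- The joint characteristic function at `t` is the transform of `W (t₁ a + t₂ b)`, which factors by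
Pythagoras. -/
theorem IsIsonormal.indepFun {s : ℝ} {W : K →L[ℝ] Lp ℝ 2 P} (hW : IsIsonormal P s W) {a b : K}
    (hab : inner ℝ a b = 0) : IndepFun (W a) (W b) P := by
  have hm : ∀ c, AEMeasurable (W c) P := fun c => (Lp.aestronglyMeasurable _).aemeasurable
  have hsmul : ∀ (t : ℝ) (c : K), charFun (P.map (W c)) t
      = Complex.exp (-(s * ‖t • c‖ ^ 2 / 2 : ℝ)) := by
    intro t c
    rw [charFun_apply_real, integral_map (hm c) (by fun_prop), ← hW (t • c), map_smul]
    refine integral_congr_ae ?_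
    filter_upwards [Lp.coeFn_smul t (W c)] with ω hω
    rw [hω]
    simp
  rw [indepFun_iff_charFun_prod (hm a) (hm b)]
  intro t
  rw [hsmul, hsmul, ← Complex.exp_add, charFun_apply, integral_map]
  · have h := hW (t.ofLp.1 • a + t.ofLp.2 • b)
    rw [norm_add_sq_real, real_inner_smul_left, real_inner_smul_right, hab] at h
    simp only [mul_zero, add_zero] at h
    rw [show (-((s * ‖t.ofLp.1 • a‖ ^ 2 / 2 : ℝ) : ℂ) + -((s * ‖t.ofLp.2 • b‖ ^ 2 / 2 : ℝ) : ℂ))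
      = -((s * (‖t.ofLp.1 • a‖ ^ 2 + ‖t.ofLp.2 • b‖ ^ 2) / 2 : ℝ) : ℂ) by push_cast; ring, ← h]
    rw [map_add, map_smul, map_smul]
    refine integral_congr_ae ?_
    filter_upwards [Lp.coeFn_smul t.ofLp.1 (W a), Lp.coeFn_smul t.ofLp.2 (W b),
      Lp.coeFn_add (t.ofLp.1 • W a) (t.ofLp.2 • W b)] with ω h1 h2 h3
    rw [h3, Pi.add_apply, h1, h2]
    simp [WithLp.prod_inner_apply]
  · exact (WithLp.measurable_toLp 2 (ℝ × ℝ)).comp_aemeasurable ((hm a).prodMk (hm b))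
  · fun_prop

theorem IsIsonormal.integral_cexp_mul {s : ℝ} (hs : 0 ≤ s) {W : K →L[ℝ] Lp ℝ 2 P}
    (hW : IsIsonormal P s W) (a : K) (z : ℂ) :
    ∫ ω, Complex.exp (z * W a ω) ∂P = Complex.exp ((s * ‖a‖ ^ 2 : ℝ) * z ^ 2 / 2) := by
  have h := complexMGF_gaussianReal (hW.map_eq hs a) z
  rw [complexMGF] at h
  rw [h, Real.coe_toNNReal _ (by positivity)]
  simp

/-- The joint Laplace–Fourier transform of two variables of an isonormal process. -/
theorem IsIsonormal.integral_cexp_add {s : ℝ} (hs : 0 ≤ s) {W : K →L[ℝ] Lp ℝ 2 P}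
    (hW : IsIsonormal P s W) (a b : K) (r : ℝ) :
    ∫ ω, Complex.exp (W a ω * Complex.I + (r * W b ω : ℝ)) ∂P
      = Complex.exp ((-(s * ‖a‖ ^ 2 / 2) + s * ‖b‖ ^ 2 * r ^ 2 / 2 : ℝ)
        + (s * r * inner ℝ a b : ℝ) * Complex.I) := by
  -- `c b` is the projection of `a` onto the line of `b`; the remainder `a - c b` yields a variable
  -- independent of `W b`.
  obtain ⟨c, hc⟩ : ∃ c : ℝ, inner ℝ a b = c * ‖b‖ ^ 2 := by
    by_cases hb : b = 0
    · exact ⟨0, by simp [hb]⟩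
    · exact ⟨inner ℝ a b / ‖b‖ ^ 2, by field_simp⟩
  have horth : inner ℝ (a - c • b) b = 0 := by
    rw [inner_sub_left, real_inner_smul_left, hc, real_inner_self_eq_norm_sq, sub_self]
  have hind := (hW.indepFun horth).comp
    (φ := fun x : ℝ => Complex.exp (x * Complex.I))
    (ψ := fun x : ℝ => Complex.exp ((c * Complex.I + r) * x)) (by fun_prop) (by fun_prop)
  have hm : ∀ c, AEStronglyMeasurable (W c) P := fun c => Lp.aestronglyMeasurable _
  have h := hind.integral_fun_mul_eq_mul_integral
    ((by fun_prop : Continuous fun x : ℝ => Complex.exp (x * Complex.I)).comp_aestronglyMeasurable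
      (hm _))
    ((by fun_prop : Continuous fun x : ℝ =>
      Complex.exp ((c * Complex.I + r) * x)).comp_aestronglyMeasurable (hm _))
  simp only [Function.comp] at h
  rw [hW, hW.integral_cexp_mul hs, ← Complex.exp_add] at h
  have hnorm : ‖a - c • b‖ ^ 2 = ‖a‖ ^ 2 - c ^ 2 * ‖b‖ ^ 2 := by
    rw [norm_sub_sq_real, real_inner_smul_right, hc, norm_smul, mul_pow, Real.norm_eq_abs, sq_abs]
    ring
  calc ∫ ω, Complex.exp (W a ω * Complex.I + (r * W b ω : ℝ)) ∂P
      = ∫ ω, Complex.exp (W (a - c • b) ω * Complex.I)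
          * Complex.exp ((c * Complex.I + r) * W b ω) ∂P := by
        refine integral_congr_ae ?_
        rw [map_sub, map_smul]
        filter_upwards [Lp.coeFn_sub (W a) (c • W b), Lp.coeFn_smul c (W b)] with ω h1 h2
        rw [h1, Pi.sub_apply, h2, ← Complex.exp_add]
        congr 1
        simp only [Pi.smul_apply, smul_eq_mul]
        push_cast
        ring
    _ = _ := by
        rw [h, hnorm, hc]
        congr 1
        push_cast
        linear_combination (s * ‖b‖ ^ 2 * c ^ 2 / 2 : ℂ) * Complex.I_sq

theorem IsIsonormal.integrable_exp {s : ℝ} (hs : 0 ≤ s) {W : K →L[ℝ] Lp ℝ 2 P}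
    (hW : IsIsonormal P s W) (b : K) (r : ℝ) : Integrable (fun ω => Real.exp (r * W b ω)) P := by
  have hm : AEMeasurable (W b) P := (Lp.aestronglyMeasurable _).aemeasurable
  have h : Integrable (fun x => Real.exp (r * x)) (P.map (W b)) := by
    rw [hW.map_eq hs]
    exact integrable_exp_mul_gaussianReal r
  exact h.comp_aemeasurable hm

end Isonormal

/-! ### Translations by vectors of `H` -/

section Shift

variable {H : Type*} {B : Type*}
  [NormedAddCommGroup H] [InnerProductSpace ℝ H] [CompleteSpace H]
  [NormedAddCommGroup B] [NormedSpace ℝ B] [CompleteSpace B] [SecondCountableTopology B]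
  [MeasurableSpace B] [BorelSpace B]

/-- The Cameron–Martin formula. -/
theorem map_add_eq_tilted {i : H →L[ℝ] B} (hinj : Function.Injective i)
    (hi : DenseRange i) {s : ℝ} (hs : 0 < s) (hμ : IsWienerMeasure i s (wienerMeasure i s))
    (Y : H) :
    (wienerMeasure i s).map (fun x => x + i Y)
      = (wienerMeasure i s).tilted fun x => s⁻¹ * ell i s Y x := by
  have := hμ.isProbabilityMeasure
  have hW := isIsonormal_ell hinj hi hs.le hμ
  have hint := hW.integrable_exp hs.le Y s⁻¹
  have := isProbabilityMeasure_tilted hint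
  have := Measure.isProbabilityMeasure_map (μ := wienerMeasure i s) (f := fun x => x + i Y)
    (by fun_prop)
  -- The normalizing constant of the tilted measure is the joint transform at `a = 0`.
  have hZ : ∫ x, Real.exp (s⁻¹ * ell i s Y x) ∂(wienerMeasure i s)
      = Real.exp (‖Y‖ ^ 2 / (2 * s)) := by
    have h := hW.integral_cexp_add hs.le 0 Y s⁻¹
    have h2 : ∫ x, Complex.exp (ell i s 0 x * Complex.I + (s⁻¹ * ell i s Y x : ℝ))
        ∂(wienerMeasure i s) = ∫ x, ((Real.exp (s⁻¹ * ell i s Y x) : ℝ) : ℂ)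
        ∂(wienerMeasure i s) := by
      refine integral_congr_ae ?_
      rw [map_zero]
      filter_upwards [Lp.coeFn_zero ℝ 2 (wienerMeasure i s)] with x hx
      rw [hx]
      simp
    rw [h2, integral_complex_ofReal] at h
    have h3 : ((-(s * ‖(0 : H)‖ ^ 2 / 2) + s * ‖Y‖ ^ 2 * s⁻¹ ^ 2 / 2 : ℝ) : ℂ)
        + (s * s⁻¹ * inner ℝ 0 Y : ℝ) * Complex.I = ((‖Y‖ ^ 2 / (2 * s) : ℝ) : ℂ) := by
      rw [inner_zero_left, norm_zero]
      have : -(s * (0 : ℝ) ^ 2 / 2) + s * ‖Y‖ ^ 2 * s⁻¹ ^ 2 / 2 = ‖Y‖ ^ 2 / (2 * s) := by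
        field_simp
        ring
      rw [this]
      simp
    rw [h3, ← Complex.ofReal_exp] at h
    exact_mod_cast h
  refine Measure.ext_of_charFunDual (funext fun u => ?_)
  rw [charFunDual_map_add_const, hμ.charFunDual_eq hi hs.le, charFunDual_apply, integral_tilted, hZ]
  -- With `r = s⁻¹` the cross term becomes `⟪dualIncl i u, Y⟫ = u (i Y)`, the phase produced by the
  -- translation.
  have h := hW.integral_cexp_add hs.le (dualIncl i u) Y s⁻¹
  have h4 : ∫ x, (Real.exp (s⁻¹ * ell i s Y x) / Real.exp (‖Y‖ ^ 2 / (2 * s)))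
        • Complex.exp (u x * Complex.I) ∂(wienerMeasure i s)
      = Complex.exp (-(‖Y‖ ^ 2 / (2 * s) : ℝ))
        * ∫ x, Complex.exp (ell i s (dualIncl i u) x * Complex.I + (s⁻¹ * ell i s Y x : ℝ))
          ∂(wienerMeasure i s) := by
    rw [← integral_const_mul]
    refine integral_congr_ae ?_
    filter_upwards [ell_dualIncl hinj hi hs.le hμ u] with x hx
    rw [hx, ← Real.exp_sub, Complex.real_smul, Complex.ofReal_exp, ← Complex.exp_add,
      ← Complex.exp_add]
    congr 1
    push_cast
    ring
  rw [h4, h, ← Complex.exp_add, ← Complex.exp_add, inner_dualIncl]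
  congr 1
  have hs' : (s : ℂ) ≠ 0 := by exact_mod_cast hs.ne'
  push_cast
  field_simp
  ring

theorem ae_add_of_ae {i : H →L[ℝ] B} (hinj : Function.Injective i)
    (hi : DenseRange i) {s : ℝ} (hs : 0 < s) (hμ : IsWienerMeasure i s (wienerMeasure i s))
    (Y : H) {p : B → Prop} (hp : ∀ᵐ x ∂(wienerMeasure i s), p x) :
    ∀ᵐ x ∂(wienerMeasure i s), p (x + i Y) := by
  have h : (wienerMeasure i s).map (fun x => x + i Y) ≪ wienerMeasure i s := by
    rw [map_add_eq_tilted hinj hi hs hμ]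
    exact tilted_absolutelyContinuous _ _
  exact ae_of_ae_map (by fun_prop) (h.ae_le hp)

/-- For functionals on `B` this is linearity. In general, functionals approximating `a` converge
almost everywhere along a subsequence, and also at `x + i Y` because translation preserves null
sets. -/
theorem ell_add {i : H →L[ℝ] B} (hinj : Function.Injective i)
    (hi : DenseRange i) {s : ℝ} (hs : 0 < s) (hμ : IsWienerMeasure i s (wienerMeasure i s))
    (a Y : H) :
    ∀ᵐ x ∂(wienerMeasure i s), ell i s a (x + i Y) = ell i s a x + inner ℝ a Y := by
  obtain ⟨v, hv, hva⟩ := mem_closure_iff_seq_limit.1 (denseRange_dualIncl hinj a)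
  choose u hu using hv
  have hlim : Tendsto (fun n => ell i s (v n)) atTop (𝓝 (ell i s a)) :=
    ((ell i s).continuous.tendsto a).comp hva
  obtain ⟨ns, hns, hae⟩ := (tendstoInMeasure_of_tendsto_Lp hlim).exists_seq_tendsto_ae
  have hu' : ∀ᵐ x ∂(wienerMeasure i s), ∀ n, ell i s (v n) x = u n x := by
    rw [ae_all_iff]
    intro n
    rw [← hu n]
    exact ell_dualIncl hinj hi hs.le hμ (u n)
  have hae' : ∀ᵐ x ∂(wienerMeasure i s),
      Tendsto (fun k => u (ns k) x) atTop (𝓝 (ell i s a x)) := by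
    filter_upwards [hae, hu'] with x hx hux
    simpa only [hux] using hx
  filter_upwards [hae', ae_add_of_ae hinj hi hs hμ Y hae'] with x h1 h2
  have h3 : Tendsto (fun k => inner ℝ (v (ns k)) Y) atTop (𝓝 (inner ℝ a Y)) :=
    (hva.comp hns.tendsto_atTop).inner tendsto_const_nhds
  refine tendsto_nhds_unique h2 ((h1.add h3).congr fun k => ?_)
  rw [map_add, ← hu, inner_dualIncl]

theorem projTilde_add {i : H →L[ℝ] B} (hinj : Function.Injective i)
    (hi : DenseRange i) {s : ℝ} (hs : 0 < s) (hμ : IsWienerMeasure i s (wienerMeasure i s))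
    (E : Submodule ℝ H) [FiniteDimensional ℝ E] (Y : H) :
    ∀ᵐ x ∂(wienerMeasure i s),
      projTilde i s E (x + i Y) = projTilde i s E x + E.starProjection Y := by
  have h := ae_all_iff.2 fun j => ell_add hinj hi hs hμ (stdOrthonormalBasis ℝ E j : H) Y
  filter_upwards [h] with x hx
  simp only [projTilde, hx, add_smul, Finset.sum_add_distrib]
  simp [(stdOrthonormalBasis ℝ E).starProjection_eq_sum_rankOne]

end Shift

end WienerSpace

/-! ### Decomposition of a positive trace-class operator -/

namespace WienerSpace

universe u

/-- A positive semidefinite form is the pullback of the scalar product of a Hilbert space. -/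
theorem exists_linearMap_inner_eq {V : Type u} [AddCommGroup V] [Module ℝ V]
    (c : PreInnerProductSpace.Core ℝ V) :
    ∃ (G : Type u) (_ : NormedAddCommGroup G) (_ : InnerProductSpace ℝ G) (_ : CompleteSpace G)
      (R : V →ₗ[ℝ] G), ∀ x y, inner ℝ (R x) (R y) = c.inner x y := by
  let : SeminormedAddCommGroup V := InnerProductSpace.Core.toSeminormedAddCommGroup (c := c)
  let : InnerProductSpace ℝ V := InnerProductSpace.ofCore c
  -- The Hausdorff completion also identifies vectors that differ by a null vector of the form.
  refine ⟨UniformSpace.Completion V, inferInstance, inferInstance, inferInstance,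
    (UniformSpace.Completion.toComplL (𝕜 := ℝ) (E := V)).toLinearMap, fun x y => ?_⟩
  exact UniformSpace.Completion.inner_coe x y

/-- Factor `T = R* R` and set `a_k = R* g_k` for a Hilbert basis `(g_k)` of the target of `R`; the
expansion is Parseval. No spectral theorem is involved. -/
theorem exists_hasSum_inner_mul_inner {K : Type u} [NormedAddCommGroup K] [InnerProductSpace ℝ K]
    [CompleteSpace K] {T : K →L[ℝ] K} (hT : IsPositiveTraceClass T) :
    ∃ (κ : Type u) (a : κ → K), (Summable fun k => ‖a k‖ ^ 2) ∧
      ∀ X Y, HasSum (fun k => inner ℝ (a k) X * inner ℝ (a k) Y) (inner ℝ (T X) Y) := by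
  obtain ⟨hpos, ι, e, he⟩ := hT
  obtain ⟨G, _, _, _, R, hR⟩ := exists_linearMap_inner_eq (V := K)
    { inner := fun x y => inner ℝ (T x) y
      conj_inner_symm := fun x y => by
        rw [hpos.isSymmetric.apply_clm y x, real_inner_comm]; rfl
      re_inner_nonneg := fun x => hpos.inner_nonneg_left x
      add_left := fun x y z => by rw [map_add, inner_add_left]
      smul_left := fun x y r => by rw [map_smul, inner_smul_left] }
  let R' : K →L[ℝ] G := R.mkContinuous (√‖T‖) fun x => by
    rw [← sq_le_sq₀ (norm_nonneg _) (by positivity), mul_pow, Real.sq_sqrt (norm_nonneg _),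
      ← real_inner_self_eq_norm_sq, hR, pow_two, ← mul_assoc]
    exact (real_inner_le_norm _ _).trans (by gcongr; exact T.le_opNorm x)
  have hR' : ∀ x y, inner ℝ (R' x) (R' y) = inner ℝ (T x) y := hR
  obtain ⟨w, g, -⟩ := exists_hilbertBasis ℝ G
  have hsum : ∀ X Y, HasSum (fun k => inner ℝ (R'.adjoint (g k)) X
      * inner ℝ (R'.adjoint (g k)) Y) (inner ℝ (T X) Y) := by
    intro X Y
    simp only [ContinuousLinearMap.adjoint_inner_left]
    rw [← hR']
    refine (g.hasSum_inner_mul_inner (R' X) (R' Y)).congr_fun ?_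
    intro k
    rw [real_inner_comm]
  refine ⟨w, fun k => R'.adjoint (g k), ?_, hsum⟩
  have h1 : ∀ k, HasSum (fun j => inner ℝ (R'.adjoint (g k)) (e j) ^ 2)
      (‖R'.adjoint (g k)‖ ^ 2) := by
    intro k
    have := e.hasSum_inner_mul_inner (R'.adjoint (g k)) (R'.adjoint (g k))
    rw [real_inner_self_eq_norm_sq] at this
    refine this.congr_fun fun j => ?_
    rw [pow_two, real_inner_comm (e j)]
  have h2 : ∀ j, HasSum (fun k => inner ℝ (R'.adjoint (g k)) (e j) ^ 2)
      (inner ℝ (T (e j)) (e j)) := by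
    intro j
    refine (hsum (e j) (e j)).congr_fun fun k => ?_
    rw [pow_two]
  -- Tonelli: `∑ |a_k|² = ∑∑ ⟪a_k, e_j⟫²` equals the trace `∑ ⟪T e_j, e_j⟫`.
  have h3 : ∑' k, ENNReal.ofReal (‖R'.adjoint (g k)‖ ^ 2) ≠ ∞ := by
    calc ∑' k, ENNReal.ofReal (‖R'.adjoint (g k)‖ ^ 2)
        = ∑' k, ∑' j, ENNReal.ofReal (inner ℝ (R'.adjoint (g k)) (e j) ^ 2) := by
          refine tsum_congr fun k => ?_
          rw [← (h1 k).tsum_eq, ENNReal.ofReal_tsum_of_nonneg (fun _ => sq_nonneg _)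
            (h1 k).summable]
      _ = ∑' j, ∑' k, ENNReal.ofReal (inner ℝ (R'.adjoint (g k)) (e j) ^ 2) := ENNReal.tsum_comm
      _ = ∑' j, ENNReal.ofReal (inner ℝ (T (e j)) (e j)) := by
          refine tsum_congr fun j => ?_
          rw [← (h2 j).tsum_eq, ENNReal.ofReal_tsum_of_nonneg (fun _ => sq_nonneg _)
            (h2 j).summable]
      _ ≠ ∞ := he.tsum_ofReal_ne_top
  refine (ENNReal.summable_toReal h3).congr fun k => ?_
  rw [ENNReal.toReal_ofReal (by positivity)]

/-- The parallelogram identity, with the term at `X - Y` dropped by positivity. -/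
theorem inner_apply_add_le {H : Type*} [NormedAddCommGroup H] [InnerProductSpace ℝ H]
    {T : H →L[ℝ] H} (hT : T.IsPositive) (X Y : H) :
    inner ℝ (T (X + Y)) (X + Y) ≤ 2 * inner ℝ (T X) X + 2 * inner ℝ (T Y) Y := by
  have h := hT.inner_nonneg_left (X - Y)
  simp only [map_add, map_sub, inner_add_left, inner_add_right, inner_sub_left,
    inner_sub_right] at h ⊢
  linarith

theorem starProjection_eq_sum_stdOrthonormalBasis {H : Type*} [NormedAddCommGroup H]
    [InnerProductSpace ℝ H] (E : Submodule ℝ H) [FiniteDimensional ℝ E]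
    (b : H) : E.starProjection b
      = ∑ j, inner ℝ b (stdOrthonormalBasis ℝ E j : H) • (stdOrthonormalBasis ℝ E j : H) := by
  simp [(stdOrthonormalBasis ℝ E).starProjection_eq_sum_rankOne, real_inner_comm]

theorem tendsto_starProjection_of_dense {H : Type*} [NormedAddCommGroup H]
    [InnerProductSpace ℝ H] [CompleteSpace H] {E : ℕ → Submodule ℝ H} [∀ n, FiniteDimensional ℝ (E n)]
    (hE : Monotone E) (hd : Dense (⋃ n, (E n : Set H))) (b : H) :
    Tendsto (fun n => (E n).starProjection b) atTop (𝓝 b) := by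
  have htop : (⨆ n, E n).topologicalClosure = ⊤ := by
    rw [← Submodule.dense_iff_topologicalClosure_eq_top]
    rwa [Submodule.coe_iSup_of_directed _ hE.directed_le]
  exact Submodule.starProjection_tendsto_self E hE b htop.ge

/-! ### The stochastic extension of the quadratic form and its growth -/

section QuadraticForm

variable {H : Type u} {B : Type*}
  [NormedAddCommGroup H] [InnerProductSpace ℝ H] [CompleteSpace H]
  [NormedAddCommGroup B] [NormedSpace ℝ B]

section Bilinear

variable {H : Type*} [NormedAddCommGroup H] [InnerProductSpace ℝ H]
  {F : Type*} [NormedAddCommGroup F] [NormedSpace ℝ F] (M : H →L[ℝ] H →L[ℝ] F)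
  {T : H →L[ℝ] H} {κ : Type*} {a : κ → H}

/-- Each `π_E a_k` is expanded in the basis of `E` and the sum over `k` taken inside the finite
sums. For `M a b = ℓ_a ℓ_b` the result is `φ ∘ π̃_E`. -/
theorem hasSum_bilin_starProjection
    (haT : ∀ X Y, HasSum (fun k => inner ℝ (a k) X * inner ℝ (a k) Y) (inner ℝ (T X) Y))
    (E : Submodule ℝ H) [FiniteDimensional ℝ E] :
    HasSum (fun k => M (E.starProjection (a k)) (E.starProjection (a k)))
      (∑ j, ∑ l, inner ℝ (T (stdOrthonormalBasis ℝ E j : H)) (stdOrthonormalBasis ℝ E l : H)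
        • M (stdOrthonormalBasis ℝ E j : H) (stdOrthonormalBasis ℝ E l : H)) := by
  have : ∀ k, M (E.starProjection (a k)) (E.starProjection (a k))
      = ∑ j, ∑ l, (inner ℝ (a k) (stdOrthonormalBasis ℝ E j : H)
        * inner ℝ (a k) (stdOrthonormalBasis ℝ E l : H))
        • M (stdOrthonormalBasis ℝ E j : H) (stdOrthonormalBasis ℝ E l : H) := fun k => by
    rw [starProjection_eq_sum_stdOrthonormalBasis, map_sum M, sum_apply]
    refine Finset.sum_congr rfl fun j _ => ?_
    rw [map_smul M, smul_apply, map_sum, Finset.smul_sum]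
    refine Finset.sum_congr rfl fun l _ => ?_
    rw [map_smul, smul_smul]
  simp only [this]
  exact hasSum_sum fun j _ => hasSum_sum fun l _ => (haT _ _).smul_const _

/-- Dominated convergence for series: projections are contractions, so `‖M‖ ‖a_k‖²` dominates
uniformly in `n`. -/
theorem tendsto_tsum_bilin_starProjection [CompleteSpace H] [CompleteSpace F] (ha : Summable fun k => ‖a k‖ ^ 2)
    {E : ℕ → Submodule ℝ H} [∀ n, FiniteDimensional ℝ (E n)]
    (hE : Monotone E) (hd : Dense (⋃ n, (E n : Set H))) :
    Tendsto (fun n => ∑' k, M ((E n).starProjection (a k)) ((E n).starProjection (a k)))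
      atTop (𝓝 (∑' k, M (a k) (a k))) := by
  refine tendsto_tsum_of_dominated_convergence (bound := fun k => ‖M‖ * ‖a k‖ ^ 2)
    (ha.mul_left _) (fun k => ?_) (Eventually.of_forall fun n k => ?_)
  · have hq : Continuous fun b => M b b := by fun_prop
    exact (hq.tendsto (a k)).comp (tendsto_starProjection_of_dense hE hd (a k))
  · have h1 := M.le_opNorm₂ ((E n).starProjection (a k)) ((E n).starProjection (a k))
    have h2 := (E n).norm_starProjection_apply_le (a k)
    refine h1.trans ?_
    rw [pow_two, ← mul_assoc]
    exact mul_le_mul (mul_le_mul_of_nonneg_left h2 M.opNorm_nonneg) h2 (norm_nonneg _)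
      (mul_nonneg M.opNorm_nonneg (norm_nonneg _))

end Bilinear

theorem coeFn_sum_mulBilin_ae_eq [MeasurableSpace B] [OpensMeasurableSpace B]
    {i : H →L[ℝ] B} {s : ℝ} (hs : 0 ≤ s) [IsProbabilityMeasure (wienerMeasure i s)]
    (hW : IsIsonormal (wienerMeasure i s) s (ell i s)) (T : H →L[ℝ] H)
    (E : Submodule ℝ H) [FiniteDimensional ℝ E] :
    (∑ j, ∑ l, inner ℝ (T (stdOrthonormalBasis ℝ E j : H)) (stdOrthonormalBasis ℝ E l : H)
        • hW.mulBilin hs (stdOrthonormalBasis ℝ E j : H) (stdOrthonormalBasis ℝ E l : H) :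
          Lp ℝ 2 (wienerMeasure i s)) =ᵐ[wienerMeasure i s]
      fun x => inner ℝ (T (projTilde i s E x)) (projTilde i s E x) := by
  set u : Fin (Module.finrank ℝ E) → H := fun j => (stdOrthonormalBasis ℝ E j : H)
  set M := hW.mulBilin hs
  have h3 : ∀ᵐ x ∂(wienerMeasure i s), ∀ p : Fin (Module.finrank ℝ E) × Fin (Module.finrank ℝ E),
      (inner ℝ (T (u p.1)) (u p.2) • M (u p.1) (u p.2) : Lp ℝ 2 (wienerMeasure i s)) x
        = inner ℝ (T (u p.1)) (u p.2) * (ell i s (u p.1) x * ell i s (u p.2) x) := by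
    refine ae_all_iff.2 fun p => ?_
    filter_upwards [Lp.coeFn_smul (inner ℝ (T (u p.1)) (u p.2)) (M (u p.1) (u p.2)),
      hW.coeFn_mulBilin hs (u p.1) (u p.2)] with x hx hx'
    rw [hx, Pi.smul_apply, hx', smul_eq_mul]
  change ((∑ j, ∑ l, inner ℝ (T (u j)) (u l) • M (u j) (u l) : Lp ℝ 2 (wienerMeasure i s)) : B → ℝ)
    =ᵐ[wienerMeasure i s] _
  rw [← Finset.sum_product']
  filter_upwards [h3, Lp.coeFn_finsetSum (Finset.univ ×ˢ Finset.univ)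
    fun p : Fin (Module.finrank ℝ E) × Fin (Module.finrank ℝ E) =>
      inner ℝ (T (u p.1)) (u p.2) • M (u p.1) (u p.2)] with x hx hx'
  rw [hx']
  simp only [Finset.sum_apply, hx]
  rw [Finset.sum_product]
  change _ = inner ℝ (T (∑ j, ell i s (u j) x • u j)) (∑ j, ell i s (u j) x • u j)
  simp only [map_sum, map_smul, sum_inner]
  refine Finset.sum_congr rfl fun j _ => ?_
  rw [real_inner_smul_left, inner_sum, Finset.mul_sum]
  refine Finset.sum_congr rfl fun l _ => ?_
  rw [real_inner_smul_right]
  ring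

theorem isLpStochasticExtension_tsum_mulBilin [MeasurableSpace B] [OpensMeasurableSpace B]
    {i : H →L[ℝ] B} {s : ℝ} (hs : 0 ≤ s) [IsProbabilityMeasure (wienerMeasure i s)]
    (hW : IsIsonormal (wienerMeasure i s) s (ell i s)) {T : H →L[ℝ] H} {κ : Type*} {a : κ → H}
    (ha : Summable fun k => ‖a k‖ ^ 2)
    (haT : ∀ X Y, HasSum (fun k => inner ℝ (a k) X * inner ℝ (a k) Y) (inner ℝ (T X) Y)) :
    IsLpStochasticExtension i s 2 (fun X => inner ℝ (T X) X)
      (∑' k, hW.mulBilin hs (a k) (a k) : Lp ℝ 2 (wienerMeasure i s)) := by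
  refine ⟨Lp.memLp _, fun E _ hE hd => ?_⟩
  have key : ∀ n, ((∑' k, hW.mulBilin hs ((E n).starProjection (a k))
      ((E n).starProjection (a k)) : Lp ℝ 2 (wienerMeasure i s)) : B → ℝ) =ᵐ[wienerMeasure i s]
      fun x => inner ℝ (T (projTilde i s (E n) x)) (projTilde i s (E n) x) := by
    intro n
    rw [(hasSum_bilin_starProjection (hW.mulBilin hs) haT (E n)).tsum_eq]
    exact coeFn_sum_mulBilin_ae_eq hs hW T (E n)
  refine ⟨fun n => (memLp_congr_ae (key n)).1 (Lp.memLp _), ?_⟩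
  have hlim := tendsto_tsum_bilin_starProjection (hW.mulBilin hs) ha hE hd
  refine ((Lp.tendsto_Lp_iff_tendsto_eLpNorm' _ _).1 hlim).congr fun n => ?_
  refine eLpNorm_congr_ae ?_
  filter_upwards [key n] with x hx
  rw [Pi.sub_apply, hx]

/-- On a finite measure space, convergence in measure means that every subsequence has a further one
converging almost everywhere, a property stable under continuous maps. -/
theorem tendstoInMeasure_comp_continuous {α E F : Type*} {mα : MeasurableSpace α} {μ : Measure α}
    [IsFiniteMeasure μ] [PseudoEMetricSpace E] [PseudoEMetricSpace F] {G : E → F}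
    (hG : Continuous G) {f : ℕ → α → E} (hf : ∀ n, AEStronglyMeasurable (f n) μ) {g : α → E}
    (h : TendstoInMeasure μ f atTop g) :
    TendstoInMeasure μ (fun n x => G (f n x)) atTop fun x => G (g x) := by
  rw [exists_seq_tendstoInMeasure_atTop_iff fun n => hG.comp_aestronglyMeasurable (hf n)]
  rw [exists_seq_tendstoInMeasure_atTop_iff hf] at h
  intro ns hns
  obtain ⟨ns', hns', hae⟩ := h ns hns
  refine ⟨ns', hns', ?_⟩
  filter_upwards [hae] with x hx
  exact (hG.tendsto _).comp hx

theorem IsLpStochasticExtension.comp_continuous [MeasurableSpace B] [OpensMeasurableSpace B]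
    [MeasurableSpace H] [OpensMeasurableSpace H]
    {i : H →L[ℝ] B} {s : ℝ} [IsFiniteMeasure (wienerMeasure i s)] {p : ℝ≥0∞} (hp : p ≠ 0)
    {f : H → ℝ} (hf : Continuous f) {g : B → ℝ} (hgm : Measurable g)
    (hg : IsLpStochasticExtension i s p f g)
    {F : Type*} [NormedAddCommGroup F] [MeasurableSpace F] [BorelSpace F] {G : ℝ → F}
    (hG : Continuous G) :
    IsStochasticExtension i s (fun X => G (f X)) fun x => G (g x) := by
  refine ⟨(hG.comp hf).measurable, hG.measurable.comp hgm, fun E _ hE hd => ?_⟩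
  obtain ⟨hmem, hlim⟩ := hg.2 E hE hd
  exact tendstoInMeasure_comp_continuous hG (fun n => (hmem n).1)
    (tendstoInMeasure_of_tendsto_eLpNorm hp (fun n => (hmem n).1) hg.1.1 hlim)

theorem exists_monotone_finiteDimensional_dense (H : Type*) [NormedAddCommGroup H]
    [InnerProductSpace ℝ H] [SecondCountableTopology H] :
    ∃ E : ℕ → Submodule ℝ H, (∀ n, FiniteDimensional ℝ (E n)) ∧ Monotone E ∧
      Dense (⋃ n, (E n : Set H)) := by
  refine ⟨fun n => Submodule.span ℝ (TopologicalSpace.denseSeq H '' Set.Iic n), fun n => ?_,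
    fun m n hmn => ?_, ?_⟩
  · exact FiniteDimensional.span_of_finite ℝ ((Set.finite_Iic n).image _)
  · exact Submodule.span_mono (Set.image_mono (Set.Iic_subset_Iic.2 hmn))
  · refine (TopologicalSpace.denseRange_denseSeq H).mono ?_
    rintro _ ⟨n, rfl⟩
    exact Set.mem_iUnion.2 ⟨n, Submodule.subset_span ⟨n, Set.mem_Iic.2 le_rfl, rfl⟩⟩

theorem growthNorm_lt_top [CompleteSpace B] [SecondCountableTopology B] [SecondCountableTopology H]
    [MeasurableSpace B] [BorelSpace B]
    {i : H →L[ℝ] B} (hinj : Function.Injective i)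
    (hi : DenseRange i) {s : ℝ} (hs : 0 < s) (hμ : IsWienerMeasure i s (wienerMeasure i s))
    {T : H →L[ℝ] H} (hT : T.IsPositive) {φt : B → ℝ}
    (hφ : IsLpStochasticExtension i s 2 (fun X => inner ℝ (T X) X) φt) :
    growthNorm i s 2 φt < ∞ := by
  have := hμ.isProbabilityMeasure
  have hφ1 : MemLp φt 1 (wienerMeasure i s) := hφ.1.mono_exponent (by norm_num)
  have hbound : ∀ Y, ∀ᵐ x ∂(wienerMeasure i s),
      ‖φt (x + i Y)‖ ≤ 2 * ‖φt x‖ + 2 * (‖T‖ * ‖Y‖ ^ 2) := by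
    intro Y
    obtain ⟨E, hEfin, hE, hd⟩ := exists_monotone_finiteDimensional_dense H
    obtain ⟨hmem, hlim⟩ := hφ.2 E hE hd
    obtain ⟨ns, -, hae⟩ := (tendstoInMeasure_of_tendsto_eLpNorm (by norm_num)
      (fun n => (hmem n).1) hφ.1.1 hlim).exists_seq_tendsto_ae
    -- A single subsequence converges both at `x` and at `x + i Y`, so pointwise inequalities for
    -- `φ` pass to the limit.
    filter_upwards [hae, ae_add_of_ae hinj hi hs hμ Y hae,
      ae_all_iff.2 fun n => projTilde_add hinj hi hs hμ (E n) Y] with x h1 h2 h3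
    simp only [h3] at h2
    have h0 : 0 ≤ φt (x + i Y) :=
      ge_of_tendsto' h2 fun n => hT.inner_nonneg_left _
    rw [Real.norm_of_nonneg h0]
    have hle : φt (x + i Y) ≤ 2 * φt x + 2 * (‖T‖ * ‖Y‖ ^ 2) := by
      refine le_of_tendsto_of_tendsto' h2 ((h1.const_mul 2).add_const _) fun n => ?_
      refine (inner_apply_add_le hT _ _).trans ?_
      gcongr
      refine (real_inner_le_norm _ _).trans ?_
      rw [pow_two, ← mul_assoc]
      gcongr
      · exact (T.le_opNorm _).trans (by gcongr; exact (E _).norm_starProjection_apply_le _)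
      · exact (E _).norm_starProjection_apply_le _
    exact hle.trans (by gcongr; exact le_abs_self _)
  -- Both `1` and `‖Y‖²` are at most `(1 + ‖Y‖)²`, which makes the bound independent of `Y`.
  refine (iSup_le fun Y => ?_ : _ ≤ 2 * eLpNorm φt 1 (wienerMeasure i s)
    + ENNReal.ofReal (2 * ‖T‖)).trans_lt (ENNReal.add_lt_top.2
      ⟨ENNReal.mul_lt_top (by simp) hφ1.eLpNorm_lt_top, ENNReal.ofReal_lt_top⟩)
  refine ENNReal.div_le_of_le_mul ?_
  have h1 : eLpNorm (fun x => φt (x + i Y)) 1 (wienerMeasure i s)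
      ≤ 2 * eLpNorm φt 1 (wienerMeasure i s) + ENNReal.ofReal (2 * (‖T‖ * ‖Y‖ ^ 2)) := by
    rw [eLpNorm_one_eq_lintegral_enorm, eLpNorm_one_eq_lintegral_enorm]
    calc ∫⁻ x, ‖φt (x + i Y)‖ₑ ∂(wienerMeasure i s)
        ≤ ∫⁻ x, (2 * ‖φt x‖ₑ + ENNReal.ofReal (2 * (‖T‖ * ‖Y‖ ^ 2))) ∂(wienerMeasure i s) := by
          refine lintegral_mono_ae ?_
          filter_upwards [hbound Y] with x hx
          rw [← ofReal_norm, ← ofReal_norm]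
          refine (ENNReal.ofReal_le_ofReal hx).trans_eq ?_
          rw [ENNReal.ofReal_add (by positivity) (by positivity),
            ENNReal.ofReal_mul (by norm_num), ENNReal.ofReal_ofNat]
      _ = _ := by
          rw [lintegral_add_right _ measurable_const, lintegral_const_mul' _ _ (by simp)]
          simp
  refine h1.trans ?_
  have h2 : 1 ≤ (1 + ‖Y‖) ^ 2 := one_le_pow₀ (by linarith [norm_nonneg Y])
  have h3 : ‖Y‖ ^ 2 ≤ (1 + ‖Y‖) ^ 2 := by gcongr; linarith
  rw [add_mul, ← ENNReal.ofReal_mul (by positivity)]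
  refine add_le_add (le_mul_of_one_le_right zero_le ?_) (ENNReal.ofReal_le_ofReal ?_)
  · exact ENNReal.one_le_ofReal.2 h2
  · rw [← mul_assoc]
    gcongr

end QuadraticForm

end WienerSpace

/-! ### Construction of isonormal processes -/

namespace WienerSpace

universe u

theorem memLp_eval_infinitePi_gaussianReal {ι : Type*} (k : ι) :
    MemLp (fun ω : ι → ℝ => ω k) 2 (Measure.infinitePi fun _ : ι => gaussianReal 0 1) :=
  (memLp_id_gaussianReal 2).comp_measurePreserving
    (measurePreserving_eval_infinitePi (fun _ : ι => gaussianReal 0 1) k)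

theorem orthonormal_toLp_eval_infinitePi_gaussianReal (ι : Type*) :
    Orthonormal ℝ fun k : ι => (memLp_eval_infinitePi_gaussianReal k).toLp := by
  classical
  set P := Measure.infinitePi fun _ : ι => gaussianReal 0 1
  have hinner : ∀ j k : ι, inner ℝ (memLp_eval_infinitePi_gaussianReal j).toLp
      (memLp_eval_infinitePi_gaussianReal k).toLp = ∫ ω : ι → ℝ, ω j * ω k ∂P := by
    intro j k
    rw [L2.inner_def]
    refine integral_congr_ae ?_
    filter_upwards [(memLp_eval_infinitePi_gaussianReal j).coeFn_toLp,
      (memLp_eval_infinitePi_gaussianReal k).coeFn_toLp] with ω h1 h2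
    rw [h1, h2]
    simp [mul_comm]
  have hint : ∀ k : ι, ∫ ω : ι → ℝ, ω k ∂P = 0 := by
    intro k
    have h := (measurePreserving_eval_infinitePi (fun _ : ι => gaussianReal 0 1) k).map_eq
    have h2 := integral_id_gaussianReal (μ := 0) (v := 1)
    rw [← h, integral_map (measurable_pi_apply k).aemeasurable (by fun_prop)] at h2
    exact h2
  rw [orthonormal_iff_ite]
  intro j k
  rw [hinner]
  split_ifs with hjk
  · subst hjk
    have h := (measurePreserving_eval_infinitePi (fun _ : ι => gaussianReal 0 1) j).map_eq
    have h2 := variance_id_gaussianReal (μ := 0) (v := 1)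
    rw [variance_of_integral_eq_zero (by fun_prop) (by simp), ← h,
      integral_map (measurable_pi_apply j).aemeasurable (by fun_prop)] at h2
    simp only [id, NNReal.coe_one] at h2
    rw [← h2]
    exact integral_congr_ae (ae_of_all _ fun ω => (pow_two _).symm)
  · have hind : iIndepFun (fun (k : ι) (ω : ι → ℝ) => ω k) P :=
      iIndepFun_infinitePi (X := fun _ x => x) fun _ => measurable_id
    have h := (hind.indepFun hjk).integral_fun_mul_eq_mul_integral
      (measurable_pi_apply j).aestronglyMeasurable (measurable_pi_apply k).aestronglyMeasurable
    rw [h, hint, zero_mul]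

/-- Existence of isonormal Gaussian processes. -/
theorem exists_isIsonormal (H : Type u) [NormedAddCommGroup H] [InnerProductSpace ℝ H]
    [CompleteSpace H] {s : ℝ} (hs : 0 ≤ s) :
    ∃ (Ω : Type u) (_ : MeasurableSpace Ω) (P : Measure Ω) (_ : IsProbabilityMeasure P)
      (W : H →L[ℝ] Lp ℝ 2 P), IsIsonormal P s W := by
  classical
  obtain ⟨w, e, -⟩ := exists_hilbertBasis ℝ H
  let P := Measure.infinitePi fun _ : w => gaussianReal 0 1
  let ξ : w → Lp ℝ 2 P := fun k => (memLp_eval_infinitePi_gaussianReal k).toLp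
  have hξ : Orthonormal ℝ ξ := orthonormal_toLp_eval_infinitePi_gaussianReal w
  -- The isometry sending a Hilbert basis of `H` to independent standard Gaussian coordinates; the
  -- factor `√s` below sets the variance.
  let W₀ : H →L[ℝ] Lp ℝ 2 P :=
    hξ.orthogonalFamily.linearIsometry.toContinuousLinearMap.comp
      (e.repr.toContinuousLinearEquiv : H →L[ℝ] lp (fun _ : w => ℝ) 2)
  have hW₀ : ∀ k, W₀ (e k) = ξ k := by
    intro k
    change hξ.orthogonalFamily.linearIsometry (e.repr (e k)) = ξ k
    rw [e.repr_self, OrthogonalFamily.linearIsometry_apply_single]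
    simp
  refine ⟨w → ℝ, inferInstance, P, inferInstance, √s • W₀, ?_⟩
  have hdense : DenseRange fun c : w →₀ ℝ => Finsupp.linearCombination ℝ (e : w → H) c := by
    have h := e.dense_span
    rw [← Submodule.dense_iff_topologicalClosure_eq_top, ← Finsupp.range_linearCombination] at h
    exact h
  refine IsIsonormal.of_denseRange hdense fun c => ?_
  have h1 : ((√s • W₀) (Finsupp.linearCombination ℝ (e : w → H) c) : (w → ℝ) → ℝ)
      =ᵐ[P] fun ω => ∑ k ∈ c.support, (√s * c k) * ω k := by
    have h2 : (√s • W₀) (Finsupp.linearCombination ℝ (e : w → H) c)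
        = ∑ k ∈ c.support, (√s * c k) • ξ k := by
      rw [Finsupp.linearCombination_apply, Finsupp.sum, map_sum]
      refine Finset.sum_congr rfl fun k _ => ?_
      rw [smul_apply, map_smul, hW₀, smul_smul]
    rw [h2]
    have h3 : ∀ᵐ ω ∂P, ∀ k ∈ c.support, ((√s * c k) • ξ k : Lp ℝ 2 P) ω = (√s * c k) * ω k := by
      refine (Finset.eventually_all _).2 fun k _ => ?_
      filter_upwards [Lp.coeFn_smul (√s * c k) (ξ k),
        (memLp_eval_infinitePi_gaussianReal k).coeFn_toLp] with ω h4 h5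
      rw [h4, Pi.smul_apply, h5, smul_eq_mul]
    filter_upwards [h3, Lp.coeFn_finsetSum c.support fun k => (√s * c k) • ξ k] with ω h4 h5
    rw [h5, Finset.sum_apply]
    exact Finset.sum_congr rfl h4
  have hind : iIndepFun (fun (k : w) (ω : w → ℝ) => (√s * c k) * ω k) P :=
    iIndepFun_infinitePi (X := fun k x => (√s * c k) * x) fun _ => by fun_prop
  have hchar := iIndepFun.charFun_map_fun_finsetSum_eq_prod (s := c.support) (P := P)
    (X := fun (k : w) (ω : w → ℝ) => (√s * c k) * ω k)
    (fun k _ => ((measurable_pi_apply k).const_mul _).aemeasurable)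
    (hind.precomp (g := fun k : c.support => (k : w)) Subtype.val_injective)
  have hone : ∀ k, charFun (P.map fun ω => (√s * c k) * ω k) 1
      = Complex.exp (-(s * c k ^ 2 / 2 : ℝ)) := by
    intro k
    have h := (measurePreserving_eval_infinitePi (fun _ : w => gaussianReal 0 1) k).map_eq
    have h2 : P.map (fun ω => (√s * c k) * ω k)
        = (gaussianReal 0 1).map fun x => (√s * c k) * x := by
      rw [← h, Measure.map_map (by fun_prop) (by fun_prop)]
      rfl
    rw [h2, charFun_map_mul, charFun_gaussianReal]
    congr 1
    have : ((√s : ℝ) : ℂ) ^ 2 = s := by exact_mod_cast Real.sq_sqrt hs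
    push_cast
    rw [mul_one, mul_pow, this]
    ring
  have hnorm : ‖Finsupp.linearCombination ℝ (e : w → H) c‖ ^ 2 = ∑ k ∈ c.support, c k ^ 2 := by
    rw [Finsupp.linearCombination_apply, Finsupp.sum, ← real_inner_self_eq_norm_sq,
      e.orthonormal.inner_sum]
    exact Finset.sum_congr rfl fun k _ => by simp [pow_two]
  have h := congrFun hchar 1
  rw [Finset.prod_apply, charFun_apply_real, integral_map (Finset.measurable_fun_sum _ fun k _ =>
    (measurable_pi_apply k).const_mul _).aemeasurable (by fun_prop)] at h
  simp only [hone] at h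
  rw [hnorm, integral_congr_ae (g := fun ω => Complex.exp (((1 : ℝ) : ℂ)
    * ((∑ k ∈ c.support, (√s * c k) * ω k : ℝ) : ℂ) * Complex.I))
    (h1.mono fun ω hω => by simp only [hω]; simp), h, ← Complex.exp_sum]
  congr 1
  push_cast
  rw [Finset.sum_neg_distrib, Finset.mul_sum, Finset.sum_div]

end WienerSpace

namespace WienerSpace

universe u v

/-! ### Finite-dimensional Gaussian measures -/

section FinGaussian

variable (V : Type*) [NormedAddCommGroup V] [InnerProductSpace ℝ V] [FiniteDimensional ℝ V]
  [MeasurableSpace V] [BorelSpace V]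

theorem integrable_exp_neg_sq_norm_div {h : ℝ} (hh : 0 < h) :
    Integrable fun y : V => Real.exp (-‖y‖ ^ 2 / (2 * h)) := by
  have hb : 0 < (((2 * h)⁻¹ : ℝ) : ℂ).re := by
    rw [Complex.ofReal_re]
    positivity
  refine (GaussianFourier.integrable_cexp_neg_mul_sq_norm_add hb 0 (0 : V)).norm.congr
    (ae_of_all _ fun y => ?_)
  simp only [zero_mul, add_zero]
  rw [← Complex.ofReal_pow, ← Complex.ofReal_neg, ← Complex.ofReal_mul, Complex.norm_exp_ofReal]
  congr 1
  field_simp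

theorem isFiniteMeasure_finGaussian {h : ℝ} (hh : 0 < h) : IsFiniteMeasure (finGaussian V h) :=
  isFiniteMeasure_withDensity_ofReal ((integrable_exp_neg_sq_norm_div V hh).const_mul _).2

theorem charFun_finGaussian {h : ℝ} (hh : 0 < h) (t : V) :
    charFun (finGaussian V h) t = Complex.exp (-(h * ‖t‖ ^ 2 / 2 : ℝ)) := by
  have hb : 0 < (((2 * h)⁻¹ : ℝ) : ℂ).re := by
    rw [Complex.ofReal_re]
    positivity
  have hh' : (h : ℂ) ≠ 0 := by exact_mod_cast hh.ne'
  have key := GaussianFourier.integral_cexp_neg_mul_sq_norm_add hb Complex.I t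
  rw [charFun_apply, finGaussian, integral_withDensity_eq_integral_toReal_smul (by fun_prop)
    (ae_of_all _ fun _ => ENNReal.ofReal_lt_top)]
  have hpos : 0 < 2 * Real.pi * h := by positivity
  have h1 : ∀ y : V, (ENNReal.ofReal ((2 * Real.pi * h) ^ (-(Module.finrank ℝ V : ℝ) / 2)
        * Real.exp (-‖y‖ ^ 2 / (2 * h)))).toReal • Complex.exp ((inner ℝ y t : ℝ) * Complex.I)
      = ((((2 * Real.pi * h) ^ (-(Module.finrank ℝ V : ℝ) / 2) : ℝ)) : ℂ)
        * Complex.exp (-(((2 * h)⁻¹ : ℝ) : ℂ) * ‖y‖ ^ 2 + Complex.I * (inner ℝ t y : ℝ)) := by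
    intro y
    rw [ENNReal.toReal_ofReal (by positivity), Complex.real_smul, Complex.ofReal_mul, mul_assoc,
      Complex.ofReal_exp, ← Complex.exp_add, real_inner_comm]
    congr 2
    push_cast
    field_simp
  simp only [h1]
  rw [integral_const_mul, key, ← mul_assoc]
  -- The Gaussian integral with `b = 1 / (2h)` produces `(π / b)^(dim / 2)`, and `π / b = 2πh`
  -- cancels the normalization.
  have h2 : (((2 * Real.pi * h) ^ (-(Module.finrank ℝ V : ℝ) / 2) : ℝ) : ℂ)
      * ((Real.pi : ℂ) / (((2 * h)⁻¹ : ℝ) : ℂ)) ^ ((Module.finrank ℝ V : ℂ) / 2) = 1 := by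
    have h3 : (Real.pi : ℂ) / (((2 * h)⁻¹ : ℝ) : ℂ) = ((2 * Real.pi * h : ℝ) : ℂ) := by
      push_cast
      field_simp
    rw [h3, show ((Module.finrank ℝ V : ℂ) / 2) = (((Module.finrank ℝ V : ℝ) / 2 : ℝ) : ℂ) by
      push_cast; rfl, ← Complex.ofReal_cpow hpos.le, ← Complex.ofReal_mul, ← Real.rpow_add hpos]
    simp [neg_div]
  rw [h2, one_mul, Complex.I_sq]
  congr 1
  push_cast
  field_simp
  norm_num

end FinGaussian

/-! ### Gaussian vectors of finite-dimensional subspaces -/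

section Projection

variable {Ω : Type*} {mΩ : MeasurableSpace Ω} {P : Measure Ω}
  {H : Type*} [NormedAddCommGroup H] [InnerProductSpace ℝ H]

/-- The standard Gaussian vector of the finite-dimensional subspace `E` attached to `W`. -/
noncomputable def gaussVec (W : H →L[ℝ] Lp ℝ 2 P) (E : Submodule ℝ H) [FiniteDimensional ℝ E]
    (ω : Ω) : E :=
  ∑ j, W (stdOrthonormalBasis ℝ E j : H) ω • stdOrthonormalBasis ℝ E j

/-- A description free of the chosen basis, through which Gaussian vectors of different subspaces
are compared. -/
theorem inner_gaussVec (W : H →L[ℝ] Lp ℝ 2 P) (E : Submodule ℝ H) [FiniteDimensional ℝ E]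
    (b : H) : ∀ᵐ ω ∂P, inner ℝ b (gaussVec W E ω : H) = W (E.starProjection b) ω := by
  rw [starProjection_eq_sum_stdOrthonormalBasis, map_sum]
  have h : ∀ᵐ ω ∂P, ∀ j, W (inner ℝ b (stdOrthonormalBasis ℝ E j : H)
      • (stdOrthonormalBasis ℝ E j : H)) ω
      = inner ℝ b (stdOrthonormalBasis ℝ E j : H) * W (stdOrthonormalBasis ℝ E j : H) ω := by
    refine ae_all_iff.2 fun j => ?_
    rw [map_smul]
    filter_upwards [Lp.coeFn_smul (inner ℝ b (stdOrthonormalBasis ℝ E j : H))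
      (W (stdOrthonormalBasis ℝ E j : H))] with ω hω
    rw [hω, Pi.smul_apply, smul_eq_mul]
  filter_upwards [h, Lp.coeFn_finsetSum Finset.univ fun j =>
    W (inner ℝ b (stdOrthonormalBasis ℝ E j : H) • (stdOrthonormalBasis ℝ E j : H))] with ω h1 h2
  rw [h2, Finset.sum_apply, gaussVec, Submodule.coe_sum, inner_sum]
  refine Finset.sum_congr rfl fun j _ => ?_
  rw [h1, Submodule.coe_smul, real_inner_smul_right, mul_comm]

theorem aemeasurable_gaussVec [MeasurableSpace H] [BorelSpace H] (W : H →L[ℝ] Lp ℝ 2 P)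
    (E : Submodule ℝ H) [FiniteDimensional ℝ E] : AEMeasurable (gaussVec W E) P := by
  unfold gaussVec
  refine Finset.aemeasurable_fun_sum _ fun j _ => ?_
  exact (Lp.aestronglyMeasurable _).aemeasurable.smul_const _

theorem IsIsonormal.map_gaussVec [IsProbabilityMeasure P] [MeasurableSpace H] [BorelSpace H]
    {h : ℝ} (hh : 0 < h) {W : H →L[ℝ] Lp ℝ 2 P} (hW : IsIsonormal P h W)
    (E : Submodule ℝ H) [FiniteDimensional ℝ E] : P.map (gaussVec W E) = finGaussian E h := by
  have := isFiniteMeasure_finGaussian E hh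
  refine Measure.ext_of_charFun (funext fun t => ?_)
  rw [charFun_finGaussian E hh, charFun_apply, integral_map (aemeasurable_gaussVec W E)
    (by fun_prop)]
  have h1 := hW (t : H)
  rw [Submodule.coe_norm, ← h1]
  refine integral_congr_ae ?_
  filter_upwards [inner_gaussVec W E (t : H)] with ω hω
  rw [Submodule.starProjection_eq_self_iff.2 t.2] at hω
  rw [← hω, Submodule.coe_inner, real_inner_comm]

theorem starProjection_eq_add_of_le {V V' : Submodule ℝ H} [FiniteDimensional ℝ V]
    [FiniteDimensional ℝ V'] (hV : V ≤ V') (b : H) :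
    V'.starProjection b = V.starProjection b + (V' ⊓ Vᗮ).starProjection b := by
  rw [← sub_eq_iff_eq_add', eq_comm]
  refine Submodule.eq_starProjection_of_mem_of_inner_eq_zero ⟨?_, ?_⟩ fun d hd => ?_
  · exact V'.sub_mem (V'.starProjection_apply_mem b) (hV (V.starProjection_apply_mem b))
  · rw [SetLike.mem_coe, Submodule.mem_orthogonal']
    intro x hx
    have h1 := V'.starProjection_inner_eq_zero b x (hV hx)
    have h2 := V.starProjection_inner_eq_zero b x hx
    rw [inner_sub_left] at h1 h2 ⊢
    linarith
  · have h1 := V'.starProjection_inner_eq_zero b d hd.1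
    have h2 : inner ℝ (V.starProjection b) d = 0 :=
      (Submodule.mem_orthogonal _ _).1 hd.2 _ (V.starProjection_apply_mem b)
    rw [inner_sub_left] at h1 ⊢
    rw [inner_sub_left]
    linarith

/-- The chosen bases of the three subspaces are unrelated, so both sides are tested against a
countable dense set, where the exceptional sets can be united. -/
theorem gaussVec_eq_add_of_le [SecondCountableTopology H] (W : H →L[ℝ] Lp ℝ 2 P)
    {V V' : Submodule ℝ H} [FiniteDimensional ℝ V] [FiniteDimensional ℝ V'] (hV : V ≤ V') :
    ∀ᵐ ω ∂P, (gaussVec W V' ω : H) = gaussVec W V ω + gaussVec W (V' ⊓ Vᗮ) ω := by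
  have h : ∀ᵐ ω ∂P, ∀ n, inner ℝ (TopologicalSpace.denseSeq H n) (gaussVec W V' ω : H)
      = inner ℝ (TopologicalSpace.denseSeq H n)
        ((gaussVec W V ω : H) + gaussVec W (V' ⊓ Vᗮ) ω) := by
    refine ae_all_iff.2 fun n => ?_
    set b := TopologicalSpace.denseSeq H n
    have h1 := Lp.coeFn_add (W (V.starProjection b)) (W ((V' ⊓ Vᗮ).starProjection b))
    rw [← map_add, ← starProjection_eq_add_of_le hV] at h1
    filter_upwards [h1, inner_gaussVec W V b, inner_gaussVec W V' b,
      inner_gaussVec W (V' ⊓ Vᗮ) b] with ω h1 h2 h3 h4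
    rw [inner_add_right, h2, h3, h4, h1, Pi.add_apply]
  filter_upwards [h] with ω hω
  refine ext_inner_left ℝ fun b => ?_
  exact congrFun ((TopologicalSpace.denseRange_denseSeq H).equalizer
    (by fun_prop) (by fun_prop) (funext hω) :
      (fun b => inner ℝ b (gaussVec W V' ω : H)) = fun b => inner ℝ b
        ((gaussVec W V ω : H) + gaussVec W (V' ⊓ Vᗮ) ω)) b

end Projection

/-! ### Gross's theorem -/

section Gross

theorem exists_monotone_finGaussian_lt {H : Type*} {B : Type*} [NormedAddCommGroup H]
    [InnerProductSpace ℝ H] [SecondCountableTopology H] [MeasurableSpace H] [BorelSpace H]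
    [NormedAddCommGroup B] [NormedSpace ℝ B] {i : H →L[ℝ] B} (hi : IsAbstractWienerSpace i)
    {h : ℝ} (hh : 0 < h) :
    ∃ V : ℕ → Submodule ℝ H, (∀ n, FiniteDimensional ℝ (V n)) ∧ Monotone V ∧
      Dense (⋃ n, (V n : Set H)) ∧
      ∀ n (E : Submodule ℝ H) [FiniteDimensional ℝ E], E ≤ (V n)ᗮ →
        finGaussian E h {y : E | (1 / 2 : ℝ) ^ n < ‖i (y : H)‖} < ENNReal.ofReal ((1 / 2) ^ n) := by
  obtain ⟨E, hEfin, hE, hd⟩ := exists_monotone_finiteDimensional_dense H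
  choose F hFfin hF using fun n : ℕ => hi.measurable_norm ((1 / 2) ^ n) (by positivity) h hh
  -- `E n` gives density and the joins give monotonicity; `n + 1` ensures that `F n` itself is
  -- included.
  refine ⟨fun n => E n ⊔ (Finset.range (n + 1)).sup F, fun n => inferInstance, ?_, ?_, ?_⟩
  · intro m n hmn
    exact sup_le_sup (hE hmn) (Finset.sup_mono (Finset.range_mono (by omega)))
  · exact hd.mono (Set.iUnion_mono fun n => SetLike.coe_subset_coe.2 le_sup_left)
  · intro n D _ hD
    refine hF n D (hD.trans (Submodule.orthogonal_le ?_))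
    exact le_sup_of_le_right (Finset.le_sup (f := F) (Finset.self_mem_range_succ n))

variable {H : Type u} [NormedAddCommGroup H] [InnerProductSpace ℝ H] [CompleteSpace H]
  [SecondCountableTopology H] [MeasurableSpace H] [BorelSpace H]
  {B : Type v} [NormedAddCommGroup B] [NormedSpace ℝ B] [CompleteSpace B]
  [MeasurableSpace B] [BorelSpace B]

/-- **Gross's theorem**: an abstract Wiener space carries a Gaussian measure of each variance. -/
theorem IsAbstractWienerSpace.exists_isWienerMeasure {i : H →L[ℝ] B}
    (hi : IsAbstractWienerSpace i) {h : ℝ} (hh : 0 < h) :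
    ∃ μ : Measure B, IsWienerMeasure i h μ := by
  obtain ⟨V, hVfin, hV, hd, hsmall⟩ := exists_monotone_finGaussian_lt hi hh
  obtain ⟨Ω, mΩ, P, hP, W, hW⟩ := exists_isIsonormal H hh.le
  let S : ℕ → Ω → B := fun n ω => i (gaussVec W (V n) ω)
  have hSm : ∀ n, AEMeasurable (S n) P := fun n =>
    (i.comp (V n).subtypeL).continuous.measurable.comp_aemeasurable
      (aemeasurable_gaussVec W (V n))
  -- Borel–Cantelli: the increment at stage `n` lies in `(V n)ᗮ`, hence exceeds `2⁻ⁿ` with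
  -- probability below `2⁻ⁿ`. So `S n` is almost surely Cauchy in `B`.
  have hBC : ∀ᵐ ω ∂P, ∀ᶠ n in atTop,
      ω ∉ {ω | (1 / 2 : ℝ) ^ n < ‖i (gaussVec W (V (n + 1) ⊓ (V n)ᗮ) ω : H)‖} := by
    refine ae_eventually_notMem (ne_top_of_le_ne_top
      (summable_geometric_two : Summable fun n : ℕ => (1 / 2 : ℝ) ^ n).tsum_ofReal_ne_top
      (ENNReal.tsum_le_tsum fun n => ?_))
    have hm : MeasurableSet {y : (V (n + 1) ⊓ (V n)ᗮ : Submodule ℝ H) |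
        (1 / 2 : ℝ) ^ n < ‖i (y : H)‖} :=
      measurableSet_lt measurable_const
        (i.comp (V (n + 1) ⊓ (V n)ᗮ : Submodule ℝ H).subtypeL).continuous.norm.measurable
    have h1 := hsmall n (V (n + 1) ⊓ (V n)ᗮ) inf_le_right
    rw [← hW.map_gaussVec hh, Measure.map_apply_of_aemeasurable (aemeasurable_gaussVec W _) hm]
      at h1
    exact h1.le
  have hdiff : ∀ᵐ ω ∂P, ∀ n, S (n + 1) ω
      = S n ω + i (gaussVec W (V (n + 1) ⊓ (V n)ᗮ) ω : H) := by
    refine ae_all_iff.2 fun n => ?_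
    filter_upwards [gaussVec_eq_add_of_le W (hV n.le_succ)] with ω hω
    simp only [S]
    rw [hω, map_add]
  obtain ⟨Z, hZm, hZ⟩ := measurable_limit_of_tendsto_metrizable_ae (L := atTop) hSm (by
    filter_upwards [hBC, hdiff] with ω h1 h2
    refine cauchySeq_tendsto_of_complete (cauchySeq_of_summable_dist ?_)
    refine Summable.of_norm_bounded_eventually_nat
      (summable_geometric_two : Summable fun n : ℕ => (1 / 2 : ℝ) ^ n) ?_
    filter_upwards [h1] with n hn
    rw [Nat.succ_eq_add_one, h2, dist_self_add_right, norm_norm]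
    exact not_lt.1 hn)
  have := Measure.isProbabilityMeasure_map (μ := P) hZm.aemeasurable
  refine ⟨P.map Z, isWienerMeasure_of_charFunDual hh.le fun u => ?_⟩
  rw [charFunDual_apply, integral_map hZm.aemeasurable (by fun_prop), ← hW]
  -- Since `u (S n) = W (π_{V n} (dualIncl i u))` almost surely, this limit identifies `u (Z)` with
  -- `W (dualIncl i u)`.
  have hlim : Tendsto (fun n => W ((V n).starProjection (dualIncl i u))) atTop
      (𝓝 (W (dualIncl i u))) :=
    (W.continuous.tendsto _).comp (tendsto_starProjection_of_dense hV hd _)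
  obtain ⟨ns, hns, hae⟩ := (tendstoInMeasure_of_tendsto_Lp hlim).exists_seq_tendsto_ae
  refine integral_congr_ae ?_
  filter_upwards [hae, hZ, ae_all_iff.2 fun n => inner_gaussVec W (V n) (dualIncl i u)]
    with ω h1 h2 h3
  have h4 : Tendsto (fun k => u (S (ns k) ω)) atTop (𝓝 (u (Z ω))) :=
    (u.continuous.tendsto _).comp (h2.comp hns.tendsto_atTop)
  have h5 : u (Z ω) = W (dualIncl i u) ω := by
    refine tendsto_nhds_unique h4 (h1.congr fun k => ?_)
    rw [← h3, inner_dualIncl]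
  rw [h5]

end Gross

/-! ### Passage from `B` to `B²` -/

section Phase

variable {H : Type u} [NormedAddCommGroup H] [InnerProductSpace ℝ H]
  {B : Type v} [NormedAddCommGroup B] [NormedSpace ℝ B]

theorem phaseIncl_injective {i : H →L[ℝ] B} (hi : Function.Injective i) :
    Function.Injective (phaseIncl i) :=
  (Prod.map_injective.2 ⟨hi, hi⟩).comp (WithLp.prodContinuousLinearEquiv 2 ℝ H H).injective

theorem denseRange_phaseIncl {i : H →L[ℝ] B} (hi : DenseRange i) : DenseRange (phaseIncl i) :=
  (hi.prodMap hi).comp (WithLp.prodContinuousLinearEquiv 2 ℝ H H).surjective.denseRange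
    (i.prodMap i).continuous

theorem norm_dualIncl_phaseIncl_sq [CompleteSpace H] (i : H →L[ℝ] B) (u : StrongDual ℝ (B × B)) :
    ‖dualIncl (phaseIncl i) u‖ ^ 2
      = ‖dualIncl i (u.comp (ContinuousLinearMap.inl ℝ B B))‖ ^ 2
        + ‖dualIncl i (u.comp (ContinuousLinearMap.inr ℝ B B))‖ ^ 2 := by
  have h : dualIncl (phaseIncl i) u
      = WithLp.toLp 2 (dualIncl i (u.comp (ContinuousLinearMap.inl ℝ B B)),
        dualIncl i (u.comp (ContinuousLinearMap.inr ℝ B B))) := by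
    refine ext_inner_right ℝ fun X => ?_
    rw [inner_dualIncl, WithLp.prod_inner_apply, inner_dualIncl, inner_dualIncl,
      ContinuousLinearMap.comp_apply, ContinuousLinearMap.comp_apply, ← map_add]
    congr 1
    simp [phaseIncl, Prod.map_apply']
  rw [h, WithLp.prod_norm_sq_eq_of_L2]
  rfl

/-- Characteristic functions multiply and squared norms add. The measure on `B²` is thus obtained
without checking Gross's condition for `i × i`. -/
theorem IsWienerMeasure.prod [CompleteSpace H] [SecondCountableTopology B] [MeasurableSpace B]
    [BorelSpace B] {i : H →L[ℝ] B} (hi : DenseRange i) {s : ℝ} (hs : 0 ≤ s) {μ : Measure B}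
    (hμ : IsWienerMeasure i s μ) : IsWienerMeasure (phaseIncl i) s (μ.prod μ) := by
  have := hμ.isProbabilityMeasure
  refine isWienerMeasure_of_charFunDual hs fun u => ?_
  rw [charFunDual_prod, hμ.charFunDual_eq hi hs, hμ.charFunDual_eq hi hs,
    norm_dualIncl_phaseIncl_sq, ← Complex.exp_add]
  congr 1
  push_cast
  ring

end Phase

end WienerSpace

theorem proposition8p10
    {H : Type*} [NormedAddCommGroup H] [InnerProductSpace ℝ H] [CompleteSpace H]
    [SecondCountableTopology H] [MeasurableSpace H] [BorelSpace H]
    {B : Type*} [NormedAddCommGroup B] [NormedSpace ℝ B] [CompleteSpace B]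
    [SecondCountableTopology B] [MeasurableSpace B] [BorelSpace B]
    (i : H →L[ℝ] B) (hi : WienerSpace.IsAbstractWienerSpace i)
    (h : ℝ) (hh : 0 < h)
    (T : WienerSpace.Phase H →L[ℝ] WienerSpace.Phase H)
    (hT : WienerSpace.IsPositiveTraceClass T) :
    (∃ φt : B × B → ℝ,
      WienerSpace.IsLpStochasticExtension (WienerSpace.phaseIncl i) (h / 2) 2
        (fun X => inner ℝ (T X) X) φt) ∧
    (∀ φt : B × B → ℝ,
      WienerSpace.IsLpStochasticExtension (WienerSpace.phaseIncl i) (h / 2) 2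
        (fun X => inner ℝ (T X) X) φt →
      WienerSpace.growthNorm (WienerSpace.phaseIncl i) (h / 2) 2 φt < ∞) ∧
    (∀ t : ℝ, 0 < t → ∃ Ft : B × B → ℝ,
      WienerSpace.IsStochasticExtension (WienerSpace.phaseIncl i) (h / 2)
        (fun X => Real.exp (-t * inner ℝ (T X) X)) Ft) ∧
    (∀ G : ℝ →ᵇ ℂ, ∃ Gt : B × B → ℂ,
      WienerSpace.IsStochasticExtension (WienerSpace.phaseIncl i) (h / 2)
        (fun X => G (inner ℝ (T X) X)) Gt) := by
  have hinj := WienerSpace.phaseIncl_injective hi.injective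
  have hdense := WienerSpace.denseRange_phaseIncl hi.denseRange
  have hs : 0 < h / 2 := half_pos hh
  obtain ⟨ν, hν⟩ := hi.exists_isWienerMeasure hs
  -- Existence excludes the default value `0` of `wienerMeasure`.
  have hμ := WienerSpace.isWienerMeasure_wienerMeasure ⟨_, hν.prod hi.denseRange hs.le⟩
  have := hμ.isProbabilityMeasure
  have hW := WienerSpace.isIsonormal_ell hinj hdense hs.le hμ
  obtain ⟨κ, a, ha, haT⟩ := WienerSpace.exists_hasSum_inner_mul_inner hT
  have hφ := WienerSpace.isLpStochasticExtension_tsum_mulBilin hs.le hW ha haT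
  have hcont : Continuous fun X : WienerSpace.Phase H => inner ℝ (T X) X := by fun_prop
  have hmeas := (Lp.stronglyMeasurable (∑' k, hW.mulBilin hs.le (a k) (a k))).measurable
  refine ⟨⟨_, hφ⟩, fun φt hφt => WienerSpace.growthNorm_lt_top hinj hdense hs hμ hT.1 hφt,
    fun t _ => ⟨_, hφ.comp_continuous two_ne_zero hcont hmeas
      (G := fun r => Real.exp (-t * r)) (by fun_prop)⟩,
    fun G => ⟨_, hφ.comp_continuous two_ne_zero hcont hmeas G.continuous⟩⟩
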